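/- Throughout, $\otimes$ is the minimal C*-tensor product, $\mathcal S$ is a commutative monoid with unit $e$, and $\tau_{a,b}:A_a\otimes A_b\to A_b\otimes A_a$ is the flip. A *C\*-weakly coassociative system* (C\*-WCS) $\{(A_a,\varphi_{a,b}):a,b\in\mathcal S\}$ over $\mathcal S$ consists of unital C\*-algebras $A_a$ (with unit $I_a$) and unital $*$-homomorphisms $\varphi_{a,b}:A_{ab}\to A_a\otimes A_b$ such that 1. $(\mathrm{id}_a\otimes\varphi_{b,c})\circ\varphi_{a,bc}=(\varphi_{a,b}\otimes \mathrm{id}_c)\circ\varphi_{ab,c}$ for all $a,b,c\in\mathcal S$; 2. there is a $*$-homomorphism $\varepsilon:A_e\to\mathbb C$ such that $(A_e,\varphi_{e,e},\varepsilon)$ is a counital C\*-bialgebra, i.e. $\varphi_{e,e}$ is coassociative and $(\varepsilon\otimes\mathrm{id})\circ\varphi_{e,e}=\mathrm{id}=(\mathrm{id}\otimes\varepsilon)\circ\varphi_{e,e}$; 3. $\varphi_{e,a}(x)=I_e\otimes x$ and $\varphi_{a,e}(x)=x\otimes I_e$ for all $a\in\mathcal S$, $x\in A_a$. Put $\varphi_{a,b}^{op}=\tau_{a,b}\circ\varphi_{a,b}$.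 Given $R^{(a,b)}\in A_a\otimes A_b$ for $a,b\in\mathcal S$, the system $\{(A_a,\varphi_{a,b},R^{(a,b)})\}$ is * *locally quasi-cocommutative* if $\{(A_a,\varphi_{a,b})\}$ is a C\*-WCS, each $R^{(a,b)}$ is unitary, and $R^{(a,b)}\varphi_{a,b}(x)(R^{(a,b)})^*=\varphi^{op}_{b,a}(x)$ for all $a,b\in\mathcal S$ and $x\in A_{ab}=A_{ba}$; * *locally quasi-triangular* if it is locally quasi-cocommutative and, for all $a,b,c\in\mathcal S$, $(\varphi_{a,b}\otimes \mathrm{id}_c)(R^{(ab,c)})=R^{(a,c)}_{13}R^{(b,c)}_{23}$ and $(\mathrm{id}_a\otimes\varphi_{b,c})(R^{(a,bc)})=R^{(a,c)}_{13}R^{(a,b)}_{12}$ (leg numbering in $A_a\otimes A_b\otimes A_c$); * *locally triangular* if it is locally quasi-triangular and $R^{(a,b)}\,\tau_{b,a}(R^{(b,a)})=I_a\otimes I_b$ for all $a,b\in\mathcal S$. For $n\ge 1$ and unital C\*-algebras $A,B$, let $T^{(n)}_{A,B}:(A\otimes B)^{\otimes n}\to A^{\otimes n}\otimes B^{\otimes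 n}$ be the $*$-isomorphism with $T^{(n)}_{A,B}((x_1\otimes y_1)\otimes\cdots\otimes(x_n\otimes y_n))=(x_1\otimes\cdots\otimes x_n)\otimes(y_1\otimes\cdots\otimes y_n)$, and for a unital $*$-homomorphism $f:C\to A\otimes B$ put $f^{(n)}=T^{(n)}_{A,B}\circ f^{\otimes n}:C^{\otimes n}\to A^{\otimes n}\otimes B^{\otimes n}$. Write $T^{(n)}_{a,b}=T^{(n)}_{A_a,A_b}$. **Lemma.** Let $\{(A_a,\varphi_{a,b},R^{(a,b)}):a,b\in\mathcal S\}$ be a locally quasi-cocommutative C\*-WCS and let $n\ge1$. (i) $(\varphi_{b,a}^{(n)})^{op}=(\varphi_{b,a}^{op})^{(n)}$ for all $a,b\in\mathcal S$. (ii) With $R^{(a,b:n)}=T^{(n)}_{a,b}\bigl((R^{(a,b)})^{\otimes n}\bigr)\in A_a^{\otimes n}\otimes A_b^{\otimes n}$, the system $\{(A_a^{\otimes n},\varphi^{(n)}_{a,b},R^{(a,b:n)}):a,b\in\mathcal S\}$ is a locally quasi-cocommutative C\*-WCS. (iii) If $\{(A_a,\varphi_{a,b},R^{(a,b)})\}$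 is moreover locally quasi-triangular (resp. locally triangular), then so is $\{(A_a^{\otimes n},\varphi^{(n)}_{a,b},R^{(a,b:n)})\}$. -/

import Mathlib

universe u v

open scoped TensorProduct InnerProductSpace CStarAlgebra

noncomputable section

/-! ### Hilbert space tensor products, representations and the minimal C⋆-tensor product -/

section HilbertTensor

variable {H K : Type*} [NormedAddCommGroup H] [InnerProductSpace ℂ H] [CompleteSpace H]
  [NormedAddCommGroup K] [InnerProductSpace ℂ K] [CompleteSpace K]

theorem inner_tensorMap_left (S : H →L[ℂ] H) (T : K →L[ℂ] K) (x y : H ⊗[ℂ] K) :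
    ⟪TensorProduct.map S.toLinearMap T.toLinearMap x, y⟫_ℂ =
      ⟪x, TensorProduct.map (star S).toLinearMap (star T).toLinearMap y⟫_ℂ := by
  induction x with
  | zero => simp
  | add x₁ x₂ h₁ h₂ => simp only [map_add, inner_add_left, h₁, h₂]
  | tmul h k =>
    induction y with
    | zero => simp
    | add y₁ y₂ h₁ h₂ => simp only [map_add, inner_add_right, h₁, h₂]
    | tmul h' k' =>
      simp [ContinuousLinearMap.star_eq_adjoint, ContinuousLinearMap.adjoint_inner_right]

theorem exists_sub_eq_star_mul_self {A : Type*} [CStarAlgebra A] (a : A) :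
    ∃ c : A, star a * a + star c * c = algebraMap ℝ A (‖a‖ ^ 2) := by
  let _ := CStarAlgebra.spectralOrder A
  let _ := CStarAlgebra.spectralOrderedRing A
  have h : star a * a ≤ algebraMap ℝ A (‖a‖ ^ 2) := CStarAlgebra.star_mul_le_algebraMap_norm_sq
  obtain ⟨c, hc⟩ := CStarAlgebra.nonneg_iff_eq_star_mul_self.1 (sub_nonneg.2 h)
  exact ⟨c, by rw [← hc]; abel⟩

theorem norm_tensorMap_left_le (S : H →L[ℂ] H) (x : H ⊗[ℂ] K) :
    ‖TensorProduct.map S.toLinearMap LinearMap.id x‖ ≤ ‖S‖ * ‖x‖ := by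
  obtain ⟨c, hc⟩ := exists_sub_eq_star_mul_self S
  have key : ∀ U : H →L[ℂ] H, ⟪TensorProduct.map U.toLinearMap LinearMap.id x,
      TensorProduct.map U.toLinearMap LinearMap.id x⟫_ℂ =
      ⟪x, TensorProduct.map (star U * U).toLinearMap LinearMap.id x⟫_ℂ := by
    intro U
    have := inner_tensorMap_left U (1 : K →L[ℂ] K) x
      (TensorProduct.map U.toLinearMap LinearMap.id x)
    rw [star_one] at this
    refine this.trans ?_
    rw [← LinearMap.comp_apply, ← TensorProduct.map_comp]
    rfl
  have h : ‖TensorProduct.map S.toLinearMap LinearMap.id x‖ ^ 2 +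
      ‖TensorProduct.map c.toLinearMap LinearMap.id x‖ ^ 2 = (‖S‖ * ‖x‖) ^ 2 := by
    have h1 : ((‖TensorProduct.map S.toLinearMap LinearMap.id x‖ ^ 2 +
      ‖TensorProduct.map c.toLinearMap LinearMap.id x‖ ^ 2 : ℝ) : ℂ) =
        (((‖S‖ * ‖x‖) ^ 2 : ℝ) : ℂ) := by
      push_cast
      have h2 := fun z : H ⊗[ℂ] K => inner_self_eq_norm_sq_to_K (𝕜 := ℂ) z
      simp only [Complex.coe_algebraMap] at h2
      rw [← h2, ← h2, key, key]
      refine (inner_add_right (𝕜 := ℂ) x _ _).symm.trans ?_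
      rw [← LinearMap.add_apply, ← TensorProduct.map_add_left, mul_pow]
      have : (star S * S).toLinearMap + (star c * c).toLinearMap =
          ((‖S‖ : ℂ) ^ 2) • (LinearMap.id : H →ₗ[ℂ] H) := by
        rw [← ContinuousLinearMap.toLinearMap_add, hc]
        ext v
        simp [Algebra.algebraMap_eq_smul_one]
        norm_cast
      rw [this, TensorProduct.map_smul_left, TensorProduct.map_id]
      refine (inner_smul_right (𝕜 := ℂ) x x _).trans ?_
      rw [h2 x]
    exact_mod_cast h1
  refine le_of_sq_le_sq ?_ (by positivity)
  nlinarith [sq_nonneg ‖TensorProduct.map c.toLinearMap LinearMap.id x‖]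

theorem norm_tensorMap_right_le (T : K →L[ℂ] K) (x : H ⊗[ℂ] K) :
    ‖TensorProduct.map LinearMap.id T.toLinearMap x‖ ≤ ‖T‖ * ‖x‖ := by
  rw [← TensorProduct.norm_comm, ← TensorProduct.norm_comm x]
  have := norm_tensorMap_left_le T (TensorProduct.comm ℂ H K x)
  rwa [TensorProduct.map_comm] at this

variable (H K) in
/-- The Hilbert space tensor product `H ⊗ K`: the completion of the algebraic tensor product for
the inner product `⟪h ⊗ k, h' ⊗ k'⟫ = ⟪h, h'⟫ ⟪k, k'⟫`. -/
def HilbertTensor : Type _ := UniformSpace.Completion (H ⊗[ℂ] K)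

instance : NormedAddCommGroup (HilbertTensor H K) :=
  inferInstanceAs (NormedAddCommGroup (UniformSpace.Completion (H ⊗[ℂ] K)))
instance : InnerProductSpace ℂ (HilbertTensor H K) :=
  inferInstanceAs (InnerProductSpace ℂ (UniformSpace.Completion (H ⊗[ℂ] K)))
instance : CompleteSpace (HilbertTensor H K) :=
  inferInstanceAs (CompleteSpace (UniformSpace.Completion (H ⊗[ℂ] K)))

/-- The canonical map from the algebraic tensor product to the Hilbert space tensor product. -/
def HilbertTensor.of : H ⊗[ℂ] K →ₗᵢ[ℂ] HilbertTensor H K :=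
  (UniformSpace.Completion.toComplₗᵢ : H ⊗[ℂ] K →ₗᵢ[ℂ] UniformSpace.Completion (H ⊗[ℂ] K))

@[elab_as_elim]
theorem HilbertTensor.induction_on {p : HilbertTensor H K → Prop} (x : HilbertTensor H K)
    (hp : IsClosed {x | p x}) (ih : ∀ y : H ⊗[ℂ] K, p (HilbertTensor.of y)) : p x :=
  UniformSpace.Completion.induction_on x hp ih

/-- The bounded operator `S ⊗ T` on `H ⊗ K`. -/
def opTensor (S : H →L[ℂ] H) (T : K →L[ℂ] K) :
    HilbertTensor H K →L[ℂ] HilbertTensor H K :=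
  ContinuousLinearMap.completion
    (LinearMap.mkContinuous (TensorProduct.map S.toLinearMap T.toLinearMap) (‖S‖ * ‖T‖) (fun x => by
      have h : TensorProduct.map S.toLinearMap T.toLinearMap x =
          TensorProduct.map S.toLinearMap LinearMap.id
            (TensorProduct.map LinearMap.id T.toLinearMap x) := by
        rw [← LinearMap.comp_apply, ← TensorProduct.map_comp]; rfl
      rw [h, mul_assoc]
      exact (norm_tensorMap_left_le _ _).trans
        (mul_le_mul_of_nonneg_left (norm_tensorMap_right_le _ _) (norm_nonneg _))))

theorem opTensor_of (S : H →L[ℂ] H) (T : K →L[ℂ] K) (x : H ⊗[ℂ] K) :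
    opTensor S T (HilbertTensor.of x) =
      HilbertTensor.of (TensorProduct.map S.toLinearMap T.toLinearMap x) :=
  ContinuousLinearMap.completion_apply_coe _ _

theorem HilbertTensor.clm_ext {F : Type*} [NormedAddCommGroup F] [NormedSpace ℂ F]
    {f g : HilbertTensor H K →L[ℂ] F} (h : ∀ x, f (HilbertTensor.of x) = g (HilbertTensor.of x)) :
    f = g := by
  ext x
  induction x using HilbertTensor.induction_on with
  | hp => exact isClosed_eq f.continuous g.continuous
  | ih x => exact h x

theorem opTensor_mul (S S' : H →L[ℂ] H) (T T' : K →L[ℂ] K) :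
    opTensor (S * S') (T * T') = opTensor S T * opTensor S' T' := by
  refine HilbertTensor.clm_ext fun x => ?_
  rw [mul_apply_eq_comp, opTensor_of, opTensor_of, opTensor_of,
    ← LinearMap.comp_apply, ← TensorProduct.map_comp]
  rfl

theorem opTensor_one : opTensor (1 : H →L[ℂ] H) (1 : K →L[ℂ] K) = 1 := by
  refine HilbertTensor.clm_ext fun x => ?_
  rw [opTensor_of]
  exact congrArg _ (LinearMap.congr_fun (TensorProduct.map_id (R := ℂ) (M := H) (N := K)) x)

theorem opTensor_star (S : H →L[ℂ] H) (T : K →L[ℂ] K) :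
    opTensor (star S) (star T) = star (opTensor S T) := by
  rw [ContinuousLinearMap.star_eq_adjoint (opTensor S T), ContinuousLinearMap.eq_adjoint_iff]
  intro x y
  induction x using HilbertTensor.induction_on with
  | hp => apply isClosed_eq <;> fun_prop
  | ih x =>
    induction y using HilbertTensor.induction_on with
    | hp => apply isClosed_eq <;> fun_prop
    | ih y =>
      rw [opTensor_of, opTensor_of, LinearIsometry.inner_map_map,
        LinearIsometry.inner_map_map, inner_tensorMap_left, star_star, star_star]

/-- `(S, T) ↦ S ⊗ T` as a bilinear map. -/
def opTensorₗ : (H →L[ℂ] H) →ₗ[ℂ] (K →L[ℂ] K) →ₗ[ℂ]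
    (HilbertTensor H K →L[ℂ] HilbertTensor H K) :=
  LinearMap.mk₂ ℂ opTensor
    (fun S S' T => HilbertTensor.clm_ext fun x => by
      rw [add_apply, opTensor_of, opTensor_of, opTensor_of,
        ContinuousLinearMap.toLinearMap_add, TensorProduct.map_add_left, LinearMap.add_apply, map_add])
    (fun c S T => HilbertTensor.clm_ext fun x => by
      rw [smul_apply, opTensor_of, opTensor_of,
        ContinuousLinearMap.toLinearMap_smul, TensorProduct.map_smul_left, LinearMap.smul_apply, map_smul])
    (fun S T T' => HilbertTensor.clm_ext fun x => by
      rw [add_apply, opTensor_of, opTensor_of, opTensor_of,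
        ContinuousLinearMap.toLinearMap_add, TensorProduct.map_add_right, LinearMap.add_apply, map_add])
    (fun c S T => HilbertTensor.clm_ext fun x => by
      rw [smul_apply, opTensor_of, opTensor_of,
        ContinuousLinearMap.toLinearMap_smul, TensorProduct.map_smul_right, LinearMap.smul_apply, map_smul])

end HilbertTensor

/-- A (unital) `⋆`-representation `π : A → B(H)` of `A` on a Hilbert space `H`. -/
structure CStarRep (A : Type u) [CStarAlgebra A] where
  H : Type u
  [normedAddCommGroup : NormedAddCommGroup H]
  [innerProductSpace : InnerProductSpace ℂ H]
  [completeSpace : CompleteSpace H]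
  π : A →⋆ₐ[ℂ] (H →L[ℂ] H)

attribute [instance] CStarRep.normedAddCommGroup CStarRep.innerProductSpace CStarRep.completeSpace

section AlgTensor

variable (A B : Type u) [CStarAlgebra A] [CStarAlgebra B]

/-- The algebraic tensor product of two C⋆-algebras, a `⋆`-algebra. It is a separate name because it
will be given the minimal C⋆-norm. -/
def AlgTensor : Type u := A ⊗[ℂ] B

instance : Ring (AlgTensor A B) := inferInstanceAs (Ring (A ⊗[ℂ] B))
instance : StarRing (AlgTensor A B) := inferInstanceAs (StarRing (A ⊗[ℂ] B))
instance : Algebra ℂ (AlgTensor A B) := inferInstanceAs (Algebra ℂ (A ⊗[ℂ] B))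
instance : StarModule ℂ (AlgTensor A B) := inferInstanceAs (StarModule ℂ (A ⊗[ℂ] B))

variable {A B}

/-- The elementary tensor `a ⊗ b`. -/
def AlgTensor.tmul (a : A) (b : B) : AlgTensor A B := a ⊗ₜ[ℂ] b

@[elab_as_elim]
theorem AlgTensor.induction_on {p : AlgTensor A B → Prop} (x : AlgTensor A B)
    (tmul : ∀ a b, p (AlgTensor.tmul a b)) (add : ∀ x y, p x → p y → p (x + y)) : p x := by
  refine TensorProduct.induction_on (motive := p) x ?_ tmul add
  have := tmul 0 0
  rwa [AlgTensor.tmul, TensorProduct.zero_tmul] at this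

def AlgTensor.repₗ (ρ : CStarRep A) (σ : CStarRep B) :
    A ⊗[ℂ] B →ₗ[ℂ] (HilbertTensor ρ.H σ.H →L[ℂ] HilbertTensor ρ.H σ.H) :=
  TensorProduct.lift (LinearMap.compl₁₂ (opTensorₗ (H := ρ.H) (K := σ.H))
    (ρ.π : A →ₗ[ℂ] (ρ.H →L[ℂ] ρ.H)) (σ.π : B →ₗ[ℂ] (σ.H →L[ℂ] σ.H)))

def AlgTensor.repₐ (ρ : CStarRep A) (σ : CStarRep B) :
    A ⊗[ℂ] B →ₐ[ℂ] (HilbertTensor ρ.H σ.H →L[ℂ] HilbertTensor ρ.H σ.H) :=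
  Algebra.TensorProduct.algHomOfLinearMapTensorProduct (AlgTensor.repₗ ρ σ)
      (fun a₁ a₂ b₁ b₂ => by
        change opTensor (ρ.π (a₁ * a₂)) (σ.π (b₁ * b₂)) =
          opTensor (ρ.π a₁) (σ.π b₁) * opTensor (ρ.π a₂) (σ.π b₂)
        rw [map_mul, map_mul, opTensor_mul])
      (by
        change opTensor (ρ.π 1) (σ.π 1) = 1
        rw [map_one, map_one, opTensor_one])

/-- The product representation `ρ ⊗ σ`, `a ⊗ b ↦ ρ(a) ⊗ σ(b)`, on the Hilbert space tensor product. -/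
def AlgTensor.rep (ρ : CStarRep A) (σ : CStarRep B) :
    AlgTensor A B →⋆ₐ[ℂ] (HilbertTensor ρ.H σ.H →L[ℂ] HilbertTensor ρ.H σ.H) where
  toFun := AlgTensor.repₐ ρ σ
  map_one' := map_one (AlgTensor.repₐ ρ σ)
  map_mul' := map_mul (AlgTensor.repₐ ρ σ)
  map_zero' := map_zero (AlgTensor.repₐ ρ σ)
  map_add' := map_add (AlgTensor.repₐ ρ σ)
  commutes' := AlgHom.commutes (AlgTensor.repₐ ρ σ)
  map_star' := fun x => by
    refine AlgTensor.induction_on (p := fun x : AlgTensor A B => AlgTensor.repₐ ρ σ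
      (star x : AlgTensor A B) = star (AlgTensor.repₐ ρ σ x)) x ?_ ?_
    · intro a b
      change opTensor (ρ.π (star a)) (σ.π (star b)) = star (opTensor (ρ.π a) (σ.π b))
      rw [map_star, map_star, opTensor_star]
    · intro x y hx hy
      have h := map_add (AlgTensor.repₐ ρ σ)
      rw [star_add]
      refine (h _ _).trans ?_
      refine (congrArg₂ (· + ·) hx hy).trans ?_
      refine (star_add _ _).symm.trans (congrArg star (h x y).symm)

theorem AlgTensor.rep_tmul (ρ : CStarRep A) (σ : CStarRep B) (a : A) (b : B) :
    AlgTensor.rep ρ σ (AlgTensor.tmul a b) = opTensor (ρ.π a) (σ.π b) := rfl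

theorem CStarRep.norm_le (ρ : CStarRep A) (a : A) : ‖ρ.π a‖ ≤ ‖a‖ :=
  NonUnitalStarAlgHom.norm_apply_le ρ.π a

theorem norm_opTensor_le {H K : Type*} [NormedAddCommGroup H] [InnerProductSpace ℂ H]
    [CompleteSpace H] [NormedAddCommGroup K] [InnerProductSpace ℂ K] [CompleteSpace K]
    (S : H →L[ℂ] H) (T : K →L[ℂ] K) : ‖opTensor S T‖ ≤ ‖S‖ * ‖T‖ := by
  refine ContinuousLinearMap.opNorm_le_bound _ (by positivity) fun x => ?_
  induction x using HilbertTensor.induction_on with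
  | hp => apply isClosed_le <;> fun_prop
  | ih x =>
    rw [opTensor_of, LinearIsometry.norm_map, LinearIsometry.norm_map]
    have h : TensorProduct.map S.toLinearMap T.toLinearMap x =
        TensorProduct.map S.toLinearMap LinearMap.id
          (TensorProduct.map LinearMap.id T.toLinearMap x) := by
      rw [← LinearMap.comp_apply, ← TensorProduct.map_comp]; rfl
    rw [h, mul_assoc]
    exact (norm_tensorMap_left_le _ _).trans
      (mul_le_mul_of_nonneg_left (norm_tensorMap_right_le _ _) (norm_nonneg _))

theorem AlgTensor.exists_bound (x : AlgTensor A B) :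
    ∃ C, ∀ (ρ : CStarRep A) (σ : CStarRep B), ‖AlgTensor.rep ρ σ x‖ ≤ C := by
  refine AlgTensor.induction_on x ?_ ?_
  · intro a b
    refine ⟨‖a‖ * ‖b‖, fun ρ σ => ?_⟩
    rw [AlgTensor.rep_tmul]
    exact (norm_opTensor_le _ _).trans
      (mul_le_mul (ρ.norm_le a) (σ.norm_le b) (norm_nonneg _) (norm_nonneg _))
  · rintro x y ⟨C, hC⟩ ⟨D, hD⟩
    refine ⟨C + D, fun ρ σ => ?_⟩
    rw [map_add]
    exact (norm_add_le _ _).trans (add_le_add (hC ρ σ) (hD ρ σ))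

/-- The minimal (spatial) C⋆-norm: the supremum of `‖(ρ ⊗ σ)(x)‖` over all representations `ρ` of
`A` and `σ` of `B`. Since representations with arbitrary Hilbert spaces in the universe of `A` and
`B` occur, this includes faithful ones. -/
def AlgTensor.minNorm (x : AlgTensor A B) : ℝ :=
  ⨆ p : CStarRep A × CStarRep B, ‖AlgTensor.rep p.1 p.2 x‖

theorem AlgTensor.norm_rep_le (ρ : CStarRep A) (σ : CStarRep B) (x : AlgTensor A B) :
    ‖AlgTensor.rep ρ σ x‖ ≤ x.minNorm := by
  obtain ⟨C, hC⟩ := x.exists_bound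
  exact le_ciSup (f := fun p : CStarRep A × CStarRep B => ‖AlgTensor.rep p.1 p.2 x‖)
    ⟨C, by rintro _ ⟨p, rfl⟩; exact hC p.1 p.2⟩ (ρ, σ)

instance : Nonempty (CStarRep A) :=
  ⟨{ H := PUnit
     π := { toFun := fun _ => 0
            map_one' := Subsingleton.elim _ _
            map_mul' := fun _ _ => Subsingleton.elim _ _
            map_zero' := Subsingleton.elim _ _
            map_add' := fun _ _ => Subsingleton.elim _ _
            commutes' := fun _ => Subsingleton.elim _ _
            map_star' := fun _ => Subsingleton.elim _ _ } }⟩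

theorem AlgTensor.minNorm_le {x : AlgTensor A B} {C : ℝ}
    (h : ∀ (ρ : CStarRep A) (σ : CStarRep B), ‖AlgTensor.rep ρ σ x‖ ≤ C) : x.minNorm ≤ C :=
  ciSup_le fun p => h p.1 p.2

theorem AlgTensor.minNorm_nonneg (x : AlgTensor A B) : 0 ≤ x.minNorm :=
  Real.iSup_nonneg fun p => norm_nonneg (AlgTensor.rep p.1 p.2 x)

instance : Norm (AlgTensor A B) := ⟨AlgTensor.minNorm⟩

theorem AlgTensor.seminormCore : SeminormedSpace.Core ℂ (AlgTensor A B) where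
  norm_nonneg := AlgTensor.minNorm_nonneg
  norm_smul c x := by
    change (c • x).minNorm = ‖c‖ * x.minNorm
    rw [AlgTensor.minNorm, AlgTensor.minNorm, Real.mul_iSup_of_nonneg (norm_nonneg c)]
    exact iSup_congr fun p => by rw [map_smul, norm_smul]
  norm_triangle x y := AlgTensor.minNorm_le fun ρ σ => by
    rw [map_add]
    exact (norm_add_le _ _).trans (add_le_add (norm_rep_le ρ σ x) (norm_rep_le ρ σ y))

instance : SeminormedRing (AlgTensor A B) :=
  { (inferInstance : Ring (AlgTensor A B)),
    SeminormedAddCommGroup.ofCore (AlgTensor.seminormCore (A := A) (B := B)) with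
    norm_mul_le := fun x y => AlgTensor.minNorm_le fun ρ σ => by
      rw [map_mul]
      exact (norm_mul_le _ _).trans (mul_le_mul (AlgTensor.norm_rep_le ρ σ x)
        (AlgTensor.norm_rep_le ρ σ y) (norm_nonneg _) (AlgTensor.minNorm_nonneg x)) }

instance : NormedAlgebra ℂ (AlgTensor A B) where
  norm_smul_le c x := (AlgTensor.seminormCore.norm_smul c x).le

theorem AlgTensor.norm_star (x : AlgTensor A B) : ‖star x‖ = ‖x‖ := by
  change (star x).minNorm = x.minNorm
  exact iSup_congr fun p => by rw [map_star, _root_.norm_star]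

theorem AlgTensor.norm_mul_self_le (x : AlgTensor A B) : ‖x‖ * ‖x‖ ≤ ‖star x * x‖ := by
  have h : ∀ (ρ : CStarRep A) (σ : CStarRep B), ‖AlgTensor.rep ρ σ x‖ ≤ √‖star x * x‖ := by
    intro ρ σ
    refine Real.le_sqrt_of_sq_le ?_
    rw [sq, ← CStarRing.norm_star_mul_self, ← map_star, ← map_mul]
    exact AlgTensor.norm_rep_le ρ σ _
  have h2 : ‖x‖ ≤ √‖star x * x‖ := AlgTensor.minNorm_le h
  calc ‖x‖ * ‖x‖ ≤ √‖star x * x‖ * √‖star x * x‖ :=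
        mul_le_mul h2 h2 (norm_nonneg _) (Real.sqrt_nonneg _)
    _ = _ := Real.mul_self_sqrt (norm_nonneg _)

end AlgTensor

section MinTensor

variable (A B : Type u) [CStarAlgebra A] [CStarAlgebra B]

/-- The completion of the algebraic tensor product for the minimal norm. -/
def AlgTensor.Compl : Type u := UniformSpace.Completion (AlgTensor A B)

instance : NormedRing (AlgTensor.Compl A B) :=
  inferInstanceAs (NormedRing (UniformSpace.Completion (AlgTensor A B)))
instance : CompleteSpace (AlgTensor.Compl A B) :=
  inferInstanceAs (CompleteSpace (UniformSpace.Completion (AlgTensor A B)))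
instance : Algebra ℂ (AlgTensor.Compl A B) :=
  inferInstanceAs (Algebra ℂ (UniformSpace.Completion (AlgTensor A B)))

variable {A B}

def AlgTensor.Compl.ofAlg (x : AlgTensor A B) : AlgTensor.Compl A B :=
  (x : UniformSpace.Completion (AlgTensor A B))

@[elab_as_elim]
theorem AlgTensor.Compl.induction_on {p : AlgTensor.Compl A B → Prop} (x : AlgTensor.Compl A B)
    (hp : IsClosed {x | p x}) (ih : ∀ y, p (AlgTensor.Compl.ofAlg y)) : p x :=
  UniformSpace.Completion.induction_on x hp ih

theorem AlgTensor.Compl.norm_ofAlg (x : AlgTensor A B) : ‖AlgTensor.Compl.ofAlg x‖ = ‖x‖ :=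
  UniformSpace.Completion.norm_coe x

def AlgTensor.Compl.starAux : AlgTensor.Compl A B → AlgTensor.Compl A B :=
  UniformSpace.Completion.map (star : AlgTensor A B → AlgTensor A B)

theorem AlgTensor.uniformContinuous_star :
    UniformContinuous (star : AlgTensor A B → AlgTensor A B) := by
  refine LipschitzWith.uniformContinuous (K := 1) (LipschitzWith.of_dist_le_mul fun x y => ?_)
  rw [dist_eq_norm, dist_eq_norm, ← star_sub, AlgTensor.norm_star]
  simp

theorem AlgTensor.Compl.starAux_ofAlg (x : AlgTensor A B) :
    AlgTensor.Compl.starAux (AlgTensor.Compl.ofAlg x) = AlgTensor.Compl.ofAlg (star x) :=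
  UniformSpace.Completion.map_coe AlgTensor.uniformContinuous_star x

theorem AlgTensor.Compl.continuous_starAux : Continuous (AlgTensor.Compl.starAux (A := A) (B := B)) :=
  UniformSpace.Completion.continuous_map

theorem AlgTensor.Compl.ofAlg_add (x y : AlgTensor A B) :
    AlgTensor.Compl.ofAlg (x + y) = AlgTensor.Compl.ofAlg x + AlgTensor.Compl.ofAlg y :=
  UniformSpace.Completion.coe_add x y

theorem AlgTensor.Compl.ofAlg_mul (x y : AlgTensor A B) :
    AlgTensor.Compl.ofAlg (x * y) = AlgTensor.Compl.ofAlg x * AlgTensor.Compl.ofAlg y :=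
  UniformSpace.Completion.coe_mul x y

theorem AlgTensor.Compl.ofAlg_one : AlgTensor.Compl.ofAlg (1 : AlgTensor A B) = 1 := rfl

theorem AlgTensor.Compl.ofAlg_smul (c : ℂ) (x : AlgTensor A B) :
    AlgTensor.Compl.ofAlg (c • x) = c • AlgTensor.Compl.ofAlg x :=
  UniformSpace.Completion.coe_smul c x

theorem AlgTensor.Compl.continuous_smul (c : ℂ) : Continuous fun x : AlgTensor.Compl A B => c • x := by
  simp only [Algebra.smul_def]
  fun_prop

theorem AlgTensor.Compl.induction_on₂ {p : AlgTensor.Compl A B → AlgTensor.Compl A B → Prop} (x y : AlgTensor.Compl A B)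
    (hp : IsClosed {x : AlgTensor.Compl A B × AlgTensor.Compl A B | p x.1 x.2})
    (ih : ∀ x y, p (AlgTensor.Compl.ofAlg x) (AlgTensor.Compl.ofAlg y)) : p x y :=
  UniformSpace.Completion.induction_on₂ x y hp ih

instance : CStarAlgebra (AlgTensor.Compl A B) where
  star := AlgTensor.Compl.starAux
  star_involutive x := by
    induction x using AlgTensor.Compl.induction_on with
    | hp => exact isClosed_eq (AlgTensor.Compl.continuous_starAux.comp AlgTensor.Compl.continuous_starAux)
              continuous_id
    | ih x => rw [AlgTensor.Compl.starAux_ofAlg, AlgTensor.Compl.starAux_ofAlg, star_star]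
  star_mul x y := by
    have h := AlgTensor.Compl.continuous_starAux (A := A) (B := B)
    refine AlgTensor.Compl.induction_on₂ (p := fun x y => AlgTensor.Compl.starAux (x * y) = AlgTensor.Compl.starAux y * AlgTensor.Compl.starAux x) x y (isClosed_eq (by fun_prop) (by fun_prop)) fun x y => ?_
    rw [← AlgTensor.Compl.ofAlg_mul, AlgTensor.Compl.starAux_ofAlg, AlgTensor.Compl.starAux_ofAlg,
      AlgTensor.Compl.starAux_ofAlg, star_mul, AlgTensor.Compl.ofAlg_mul]
  star_add x y := by
    have h := AlgTensor.Compl.continuous_starAux (A := A) (B := B)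
    refine AlgTensor.Compl.induction_on₂ (p := fun x y => AlgTensor.Compl.starAux (x + y) = AlgTensor.Compl.starAux x + AlgTensor.Compl.starAux y) x y (isClosed_eq (by fun_prop) (by fun_prop)) fun x y => ?_
    rw [← AlgTensor.Compl.ofAlg_add, AlgTensor.Compl.starAux_ofAlg, AlgTensor.Compl.starAux_ofAlg,
      AlgTensor.Compl.starAux_ofAlg, star_add, AlgTensor.Compl.ofAlg_add]
  star_smul c x := by
    have h := AlgTensor.Compl.continuous_starAux (A := A) (B := B)
    refine AlgTensor.Compl.induction_on x (isClosed_eq (h.comp (AlgTensor.Compl.continuous_smul c))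
      ((AlgTensor.Compl.continuous_smul _).comp h)) fun x => ?_
    rw [← AlgTensor.Compl.ofAlg_smul, AlgTensor.Compl.starAux_ofAlg,
      AlgTensor.Compl.starAux_ofAlg, star_smul, AlgTensor.Compl.ofAlg_smul]
  norm_mul_self_le x := by
    change ‖x‖ * ‖x‖ ≤ ‖AlgTensor.Compl.starAux x * x‖
    have h := AlgTensor.Compl.continuous_starAux (A := A) (B := B)
    refine AlgTensor.Compl.induction_on x (isClosed_le (by fun_prop) (by fun_prop)) fun x => ?_
    rw [AlgTensor.Compl.starAux_ofAlg, ← AlgTensor.Compl.ofAlg_mul, AlgTensor.Compl.norm_ofAlg, AlgTensor.Compl.norm_ofAlg]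
    exact x.norm_mul_self_le
  norm_smul_le c x := by
    refine AlgTensor.Compl.induction_on x (isClosed_le
      (continuous_norm.comp (AlgTensor.Compl.continuous_smul c)) (by fun_prop)) fun x => ?_
    rw [← AlgTensor.Compl.ofAlg_smul, AlgTensor.Compl.norm_ofAlg, AlgTensor.Compl.norm_ofAlg]
    exact norm_smul_le c x

variable (A B) in
/-- The minimal C⋆-tensor product `A ⊗ B`, the completion of the algebraic tensor product for the
minimal norm. -/
def MinTensor : Type u := AlgTensor.Compl A B

instance : CStarAlgebra (MinTensor A B) := inferInstanceAs (CStarAlgebra (AlgTensor.Compl A B))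

/-- The canonical map from the algebraic to the minimal tensor product. -/
def MinTensor.ofAlg : AlgTensor A B →⋆ₐ[ℂ] MinTensor A B where
  toFun x := AlgTensor.Compl.ofAlg x
  map_one' := rfl
  map_mul' := AlgTensor.Compl.ofAlg_mul
  map_zero' := rfl
  map_add' := AlgTensor.Compl.ofAlg_add
  commutes' _ := rfl
  map_star' x := (AlgTensor.Compl.starAux_ofAlg x).symm

@[elab_as_elim]
theorem MinTensor.induction_on {p : MinTensor A B → Prop} (x : MinTensor A B)
    (hp : IsClosed {x | p x}) (ih : ∀ y, p (MinTensor.ofAlg y)) : p x :=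
  UniformSpace.Completion.induction_on x hp ih

theorem MinTensor.induction_on₂ {p : MinTensor A B → MinTensor A B → Prop} (x y : MinTensor A B)
    (hp : IsClosed {x : MinTensor A B × MinTensor A B | p x.1 x.2})
    (ih : ∀ x y, p (MinTensor.ofAlg x) (MinTensor.ofAlg y)) : p x y :=
  UniformSpace.Completion.induction_on₂ x y hp ih

theorem MinTensor.norm_ofAlg (x : AlgTensor A B) : ‖MinTensor.ofAlg x‖ = ‖x‖ :=
  UniformSpace.Completion.norm_coe x

end MinTensor

section Homs

variable {A B A' B' : Type u} [CStarAlgebra A] [CStarAlgebra B] [CStarAlgebra A'] [CStarAlgebra B']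

def AlgTensor.lift {D : Type*} [CStarAlgebra D] (f : A →⋆ₐ[ℂ] D) (g : B →⋆ₐ[ℂ] D)
    (h : ∀ a b, Commute (f a) (g b)) : AlgTensor A B →⋆ₐ[ℂ] D where
  toFun := Algebra.TensorProduct.lift f.toAlgHom g.toAlgHom h
  map_one' := map_one (Algebra.TensorProduct.lift f.toAlgHom g.toAlgHom h)
  map_mul' := map_mul (Algebra.TensorProduct.lift f.toAlgHom g.toAlgHom h)
  map_zero' := map_zero (Algebra.TensorProduct.lift f.toAlgHom g.toAlgHom h)
  map_add' := map_add (Algebra.TensorProduct.lift f.toAlgHom g.toAlgHom h)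
  commutes' := AlgHom.commutes (Algebra.TensorProduct.lift f.toAlgHom g.toAlgHom h)
  map_star' := fun x => by
    refine AlgTensor.induction_on (p := fun x : AlgTensor A B =>
      Algebra.TensorProduct.lift f.toAlgHom g.toAlgHom h (star x : AlgTensor A B) =
        star (Algebra.TensorProduct.lift f.toAlgHom g.toAlgHom h x)) x ?_ ?_
    · intro a b
      change f (star a) * g (star b) = star (f a * g b)
      rw [map_star, map_star, star_mul, (h a b).star_star.eq]
    · intro x y hx hy
      have h := map_add (Algebra.TensorProduct.lift f.toAlgHom g.toAlgHom h)
      rw [star_add]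
      refine (h _ _).trans ?_
      refine (congrArg₂ (· + ·) hx hy).trans ?_
      refine (star_add _ _).symm.trans (congrArg star (h x y).symm)

theorem AlgTensor.lift_tmul {D : Type*} [CStarAlgebra D] (f : A →⋆ₐ[ℂ] D) (g : B →⋆ₐ[ℂ] D)
    (h : ∀ a b, Commute (f a) (g b)) (a : A) (b : B) :
    AlgTensor.lift f g h (AlgTensor.tmul a b) = f a * g b := rfl

theorem AlgTensor.uniformContinuous_of_bound {D : Type*} [CStarAlgebra D]
    (f : AlgTensor A B →⋆ₐ[ℂ] D) (hf : ∀ x, ‖f x‖ ≤ ‖x‖) : UniformContinuous f := by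
  refine LipschitzWith.uniformContinuous (K := 1) (LipschitzWith.of_dist_le_mul fun x y => ?_)
  rw [dist_eq_norm, dist_eq_norm, ← map_sub]
  simpa using hf (x - y)

def MinTensor.extendFun {D : Type*} [CStarAlgebra D] (f : AlgTensor A B →⋆ₐ[ℂ] D) :
    MinTensor A B → D :=
  UniformSpace.Completion.extension f

theorem MinTensor.continuous_extendFun {D : Type*} [CStarAlgebra D] (f : AlgTensor A B →⋆ₐ[ℂ] D) :
    Continuous (MinTensor.extendFun f) :=
  UniformSpace.Completion.continuous_extension

theorem MinTensor.extendFun_ofAlg {D : Type*} [CStarAlgebra D] (f : AlgTensor A B →⋆ₐ[ℂ] D)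
    (hf : ∀ x, ‖f x‖ ≤ ‖x‖) (x : AlgTensor A B) :
    MinTensor.extendFun f (MinTensor.ofAlg x) = f x :=
  UniformSpace.Completion.extension_coe (AlgTensor.uniformContinuous_of_bound f hf) x

/-- A contractive `⋆`-homomorphism on the algebraic tensor product extends to `A ⊗ B`. -/
def MinTensor.extend {D : Type*} [CStarAlgebra D] (f : AlgTensor A B →⋆ₐ[ℂ] D)
    (hf : ∀ x, ‖f x‖ ≤ ‖x‖) : MinTensor A B →⋆ₐ[ℂ] D where
  toFun := MinTensor.extendFun f
  map_one' := (MinTensor.extendFun_ofAlg f hf 1).trans (map_one f)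
  map_zero' := (MinTensor.extendFun_ofAlg f hf 0).trans (map_zero f)
  map_mul' x y := by
    have hc := MinTensor.continuous_extendFun f
    refine MinTensor.induction_on₂ (p := fun x y => MinTensor.extendFun f (x * y) =
      MinTensor.extendFun f x * MinTensor.extendFun f y) x y
      (isClosed_eq (by fun_prop) (by fun_prop)) fun x y => ?_
    rw [← map_mul, extendFun_ofAlg f hf, extendFun_ofAlg f hf, extendFun_ofAlg f hf, map_mul]
  map_add' x y := by
    have hc := MinTensor.continuous_extendFun f
    refine MinTensor.induction_on₂ (p := fun x y => MinTensor.extendFun f (x + y) =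
      MinTensor.extendFun f x + MinTensor.extendFun f y) x y
      (isClosed_eq (by fun_prop) (by fun_prop)) fun x y => ?_
    rw [← map_add, extendFun_ofAlg f hf, extendFun_ofAlg f hf, extendFun_ofAlg f hf, map_add]
  commutes' c :=
    (MinTensor.extendFun_ofAlg f hf (algebraMap ℂ _ c)).trans (AlgHomClass.commutes f c)
  map_star' x := by
    have hc := MinTensor.continuous_extendFun f
    refine MinTensor.induction_on x (isClosed_eq (by fun_prop) (by fun_prop)) fun x => ?_
    rw [← map_star, extendFun_ofAlg f hf, extendFun_ofAlg f hf, map_star]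

theorem MinTensor.extend_ofAlg {D : Type*} [CStarAlgebra D] (f : AlgTensor A B →⋆ₐ[ℂ] D)
    (hf : ∀ x, ‖f x‖ ≤ ‖x‖) (x : AlgTensor A B) :
    MinTensor.extend f hf (MinTensor.ofAlg x) = f x :=
  MinTensor.extendFun_ofAlg f hf x

/-- The elementary tensor `a ⊗ b` in the minimal tensor product. -/
def MinTensor.tmul (a : A) (b : B) : MinTensor A B := MinTensor.ofAlg (AlgTensor.tmul a b)

theorem MinTensor.tmul_mul_tmul (a a' : A) (b b' : B) :
    MinTensor.tmul a b * MinTensor.tmul a' b' = MinTensor.tmul (a * a') (b * b') := by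
  rw [MinTensor.tmul, MinTensor.tmul, ← map_mul]
  exact congrArg MinTensor.ofAlg (Algebra.TensorProduct.tmul_mul_tmul a a' b b')

theorem MinTensor.star_tmul (a : A) (b : B) :
    star (MinTensor.tmul a b) = MinTensor.tmul (star a) (star b) :=
  (map_star MinTensor.ofAlg _).symm

theorem MinTensor.tmul_add (a : A) (b b' : B) :
    MinTensor.tmul a (b + b') = MinTensor.tmul a b + MinTensor.tmul a b' :=
  (congrArg MinTensor.ofAlg (TensorProduct.tmul_add a b b')).trans (map_add MinTensor.ofAlg _ _)

theorem MinTensor.add_tmul (a a' : A) (b : B) :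
    MinTensor.tmul (a + a') b = MinTensor.tmul a b + MinTensor.tmul a' b :=
  (congrArg MinTensor.ofAlg (TensorProduct.add_tmul a a' b)).trans (map_add MinTensor.ofAlg _ _)

theorem MinTensor.smul_tmul (c : ℂ) (a : A) (b : B) :
    MinTensor.tmul (c • a) b = c • MinTensor.tmul a b :=
  (congrArg MinTensor.ofAlg (TensorProduct.smul_tmul' c a b).symm).trans
    (map_smul MinTensor.ofAlg c _)

theorem MinTensor.tmul_smul (c : ℂ) (a : A) (b : B) :
    MinTensor.tmul a (c • b) = c • MinTensor.tmul a b :=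
  (congrArg MinTensor.ofAlg (TensorProduct.tmul_smul c a b)).trans
    (map_smul MinTensor.ofAlg c _)

theorem MinTensor.tmul_one_one : MinTensor.tmul (1 : A) (1 : B) = 1 := map_one MinTensor.ofAlg

theorem MinTensor.hom_ext {D : Type*} [CStarAlgebra D] {f g : MinTensor A B →⋆ₐ[ℂ] D}
    (h : ∀ a b, f (MinTensor.tmul a b) = g (MinTensor.tmul a b)) : f = g := by
  ext x
  refine MinTensor.induction_on x (isClosed_eq
    (map_continuous f) (map_continuous g)) fun x => ?_
  refine AlgTensor.induction_on x h fun x y hx hy => ?_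
  rw [map_add, map_add, map_add, hx, hy]

/-- `a ↦ a ⊗ 1`. -/
def MinTensor.includeLeft : A →⋆ₐ[ℂ] MinTensor A B where
  toFun a := MinTensor.tmul a 1
  map_one' := MinTensor.tmul_one_one
  map_mul' a a' := by rw [MinTensor.tmul_mul_tmul, one_mul]
  map_zero' := by simpa using MinTensor.smul_tmul (B := B) 0 (0 : A) 1
  map_add' a a' := MinTensor.add_tmul a a' 1
  commutes' c := by
    rw [Algebra.algebraMap_eq_smul_one, Algebra.algebraMap_eq_smul_one, MinTensor.smul_tmul,
      MinTensor.tmul_one_one]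
  map_star' a := by rw [MinTensor.star_tmul, star_one]

/-- `b ↦ 1 ⊗ b`. -/
def MinTensor.includeRight : B →⋆ₐ[ℂ] MinTensor A B where
  toFun b := MinTensor.tmul 1 b
  map_one' := MinTensor.tmul_one_one
  map_mul' a a' := by rw [MinTensor.tmul_mul_tmul, one_mul]
  map_zero' := by simpa using MinTensor.tmul_smul (A := A) 0 1 (0 : B)
  map_add' b b' := MinTensor.tmul_add 1 b b'
  commutes' c := by
    rw [Algebra.algebraMap_eq_smul_one, Algebra.algebraMap_eq_smul_one, MinTensor.tmul_smul,
      MinTensor.tmul_one_one]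
  map_star' a := by rw [MinTensor.star_tmul, star_one]

theorem MinTensor.includeLeft_apply (a : A) :
    (MinTensor.includeLeft a : MinTensor A B) = MinTensor.tmul a 1 := rfl

theorem MinTensor.includeRight_apply (b : B) :
    (MinTensor.includeRight b : MinTensor A B) = MinTensor.tmul 1 b := rfl

theorem MinTensor.commute_include (a : A) (b : B) :
    Commute (MinTensor.includeLeft a : MinTensor A B) (MinTensor.includeRight b) := by
  rw [commute_iff_eq, includeLeft_apply, includeRight_apply, tmul_mul_tmul, tmul_mul_tmul]
  simp

def MinTensor.rep (ρ : CStarRep A) (σ : CStarRep B) :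
    MinTensor A B →⋆ₐ[ℂ] (HilbertTensor ρ.H σ.H →L[ℂ] HilbertTensor ρ.H σ.H) :=
  MinTensor.extend (AlgTensor.rep ρ σ) (AlgTensor.norm_rep_le ρ σ)

theorem MinTensor.rep_ofAlg (ρ : CStarRep A) (σ : CStarRep B) (x : AlgTensor A B) :
    MinTensor.rep ρ σ (MinTensor.ofAlg x) = AlgTensor.rep ρ σ x :=
  MinTensor.extend_ofAlg _ (AlgTensor.norm_rep_le ρ σ) x

theorem MinTensor.norm_rep_le (ρ : CStarRep A) (σ : CStarRep B) (x : MinTensor A B) :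
    ‖MinTensor.rep ρ σ x‖ ≤ ‖x‖ :=
  NonUnitalStarAlgHom.norm_apply_le (MinTensor.rep ρ σ) x

theorem MinTensor.norm_le_of_rep {x : MinTensor A B} {C : ℝ}
    (h : ∀ (ρ : CStarRep A) (σ : CStarRep B), ‖MinTensor.rep ρ σ x‖ ≤ C) : ‖x‖ ≤ C := by
  refine le_of_forall_pos_le_add fun ε hε => ?_
  have hd : DenseRange (MinTensor.ofAlg : AlgTensor A B → MinTensor A B) :=
    UniformSpace.Completion.denseRange_coe
  obtain ⟨y, hy⟩ := hd.exists_dist_lt x (half_pos hε)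
  rw [dist_eq_norm] at hy
  have h1 : ‖y‖ ≤ C + ε / 2 := AlgTensor.minNorm_le fun ρ σ => by
    rw [← MinTensor.rep_ofAlg]
    have h2 : MinTensor.rep ρ σ (MinTensor.ofAlg y) =
        MinTensor.rep ρ σ x - MinTensor.rep ρ σ (x - MinTensor.ofAlg y) := by
      rw [map_sub]; abel
    rw [h2]
    exact (norm_sub_le _ _).trans (add_le_add (h ρ σ) ((norm_rep_le ρ σ _).trans hy.le))
  have h3 : ‖x‖ ≤ ‖x - MinTensor.ofAlg y‖ + ‖MinTensor.ofAlg y‖ := by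
    simpa using norm_add_le (x - MinTensor.ofAlg y) (MinTensor.ofAlg y)
  rw [MinTensor.norm_ofAlg] at h3
  linarith

def CStarRep.comp (ρ : CStarRep A') (f : A →⋆ₐ[ℂ] A') : CStarRep A where
  H := ρ.H
  π := ρ.π.comp f

theorem MinTensor.rep_tmul (ρ : CStarRep A) (σ : CStarRep B) (a : A) (b : B) :
    MinTensor.rep ρ σ (MinTensor.tmul a b) = opTensor (ρ.π a) (σ.π b) :=
  MinTensor.rep_ofAlg ρ σ _

theorem MinTensor.commute_map (f : A →⋆ₐ[ℂ] A') (g : B →⋆ₐ[ℂ] B') (a : A) (b : B) :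
    Commute ((MinTensor.includeLeft (B := B')).comp f a)
      ((MinTensor.includeRight (A := A')).comp g b) :=
  MinTensor.commute_include (f a) (g b)

def MinTensor.mapAlg (f : A →⋆ₐ[ℂ] A') (g : B →⋆ₐ[ℂ] B') : AlgTensor A B →⋆ₐ[ℂ] MinTensor A' B' :=
  AlgTensor.lift (MinTensor.includeLeft.comp f) (MinTensor.includeRight.comp g)
    (MinTensor.commute_map f g)

theorem MinTensor.mapAlg_tmul (f : A →⋆ₐ[ℂ] A') (g : B →⋆ₐ[ℂ] B') (a : A) (b : B) :
    MinTensor.mapAlg f g (AlgTensor.tmul a b) = MinTensor.tmul (f a) (g b) := by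
  refine (AlgTensor.lift_tmul _ _ (MinTensor.commute_map f g) a b).trans ?_
  change MinTensor.tmul (f a) 1 * MinTensor.tmul 1 (g b) = _
  rw [MinTensor.tmul_mul_tmul, one_mul, mul_one]

theorem MinTensor.norm_mapAlg_le (f : A →⋆ₐ[ℂ] A') (g : B →⋆ₐ[ℂ] B') (x : AlgTensor A B) :
    ‖MinTensor.mapAlg f g x‖ ≤ ‖x‖ := by
  refine MinTensor.norm_le_of_rep fun ρ σ => ?_
  have h : MinTensor.rep ρ σ (MinTensor.mapAlg f g x) =
      AlgTensor.rep (ρ.comp f) (σ.comp g) x := by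
    induction x using AlgTensor.induction_on with
    | tmul a b => rw [mapAlg_tmul, MinTensor.rep_tmul, AlgTensor.rep_tmul]; rfl
    | add x y hx hy => rw [map_add, map_add, map_add, hx, hy]; rfl
  rw [h]
  exact AlgTensor.norm_rep_le (ρ.comp f) (σ.comp g) x

/-- The tensor product `f ⊗ g` of two unital `⋆`-homomorphisms. -/
def MinTensor.map (f : A →⋆ₐ[ℂ] A') (g : B →⋆ₐ[ℂ] B') : MinTensor A B →⋆ₐ[ℂ] MinTensor A' B' :=
  MinTensor.extend (MinTensor.mapAlg f g) (MinTensor.norm_mapAlg_le f g)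

theorem MinTensor.map_tmul (f : A →⋆ₐ[ℂ] A') (g : B →⋆ₐ[ℂ] B') (a : A) (b : B) :
    MinTensor.map f g (MinTensor.tmul a b) = MinTensor.tmul (f a) (g b) :=
  (MinTensor.extend_ofAlg _ (MinTensor.norm_mapAlg_le f g) _).trans (MinTensor.mapAlg_tmul f g a b)

section

variable {H K : Type*} [NormedAddCommGroup H] [InnerProductSpace ℂ H] [CompleteSpace H]
  [NormedAddCommGroup K] [InnerProductSpace ℂ K] [CompleteSpace K]

variable (H K) in
def HilbertTensor.comm : HilbertTensor H K →L[ℂ] HilbertTensor K H :=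
  ContinuousLinearMap.completion
    (TensorProduct.commIsometry ℂ H K).toContinuousLinearEquiv.toContinuousLinearMap

theorem HilbertTensor.comm_of (x : H ⊗[ℂ] K) :
    HilbertTensor.comm H K (HilbertTensor.of x) =
      HilbertTensor.of (TensorProduct.comm ℂ H K x) :=
  ContinuousLinearMap.completion_apply_coe _ _

theorem HilbertTensor.norm_comm (x : HilbertTensor H K) : ‖HilbertTensor.comm H K x‖ = ‖x‖ := by
  induction x using HilbertTensor.induction_on with
  | hp => apply isClosed_eq <;> fun_prop
  | ih x => rw [comm_of, LinearIsometry.norm_map, LinearIsometry.norm_map, TensorProduct.norm_comm]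

theorem HilbertTensor.comm_opTensor (S : H →L[ℂ] H) (T : K →L[ℂ] K) (x : HilbertTensor H K) :
    HilbertTensor.comm H K (opTensor S T x) = opTensor T S (HilbertTensor.comm H K x) := by
  induction x using HilbertTensor.induction_on with
  | hp => apply isClosed_eq <;> fun_prop
  | ih x => rw [comm_of, opTensor_of, opTensor_of, comm_of, TensorProduct.map_comm]

end

variable (A B) in
def MinTensor.commAlg : AlgTensor A B →⋆ₐ[ℂ] MinTensor B A :=
  AlgTensor.lift MinTensor.includeRight MinTensor.includeLeft
    (fun a b => (MinTensor.commute_include b a).symm)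

theorem MinTensor.commAlg_tmul (a : A) (b : B) :
    MinTensor.commAlg A B (AlgTensor.tmul a b) = MinTensor.tmul b a := by
  refine (AlgTensor.lift_tmul _ _ (fun a b => (MinTensor.commute_include b a).symm) a b).trans ?_
  change MinTensor.tmul 1 a * MinTensor.tmul b 1 = _
  rw [MinTensor.tmul_mul_tmul, one_mul, mul_one]

theorem MinTensor.norm_commAlg_le (x : AlgTensor A B) : ‖MinTensor.commAlg A B x‖ ≤ ‖x‖ := by
  refine MinTensor.norm_le_of_rep fun ρ σ => ?_
  have h : ∀ ξ : HilbertTensor ρ.H σ.H, HilbertTensor.comm ρ.H σ.H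
      (MinTensor.rep ρ σ (MinTensor.commAlg A B x) ξ) =
        AlgTensor.rep σ ρ x (HilbertTensor.comm ρ.H σ.H ξ) := by
    intro ξ
    induction x using AlgTensor.induction_on with
    | tmul a b =>
      rw [commAlg_tmul, MinTensor.rep_tmul, AlgTensor.rep_tmul]
      exact HilbertTensor.comm_opTensor _ _ _
    | add x y hx hy =>
      rw [map_add, map_add, map_add, add_apply, add_apply, ← hx, ← hy]
      exact map_add (HilbertTensor.comm ρ.H σ.H) _ _
  refine ContinuousLinearMap.opNorm_le_bound _ (norm_nonneg _)
    fun (ξ : HilbertTensor ρ.H σ.H) => ?_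
  have h1 := (AlgTensor.rep σ ρ x).le_opNorm (HilbertTensor.comm ρ.H σ.H ξ)
  rw [← h, HilbertTensor.norm_comm, HilbertTensor.norm_comm] at h1
  exact h1.trans <| mul_le_mul_of_nonneg_right (AlgTensor.norm_rep_le σ ρ x) (norm_nonneg _)

variable (A B) in
/-- The flip `τ : A ⊗ B → B ⊗ A`. -/
def MinTensor.comm : MinTensor A B →⋆ₐ[ℂ] MinTensor B A :=
  MinTensor.extend (MinTensor.commAlg A B) MinTensor.norm_commAlg_le

theorem MinTensor.comm_tmul (a : A) (b : B) :
    MinTensor.comm A B (MinTensor.tmul a b) = MinTensor.tmul b a :=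
  (MinTensor.extend_ofAlg _ MinTensor.norm_commAlg_le _).trans (MinTensor.commAlg_tmul a b)

end Homs

section Amplification

theorem CStarAlgebra.exists_negPart {E : Type*} [CStarAlgebra E] (Z : E) (hZ : IsSelfAdjoint Z) :
    ∃ V : E, star (star V * V) = star V * V ∧
      star V * V * Z * (star V * V) = - (star (V * (star V * V)) * (V * (star V * V))) ∧
      (V * (star V * V) = 0 → ∃ U : E, Z = star U * U) := by
  let _ := CStarAlgebra.spectralOrder E
  let _ := CStarAlgebra.spectralOrderedRing E
  obtain ⟨V, hV⟩ := CStarAlgebra.nonneg_iff_eq_star_mul_self.1 (CFC.negPart_nonneg Z)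
  have hsa : star (star V * V) = star V * V := by simp
  refine ⟨V, hsa, ?_, fun h => ?_⟩
  · rw [star_mul, hsa, ← hV]
    have h1 : Z⁻ * Z = - (Z⁻ * Z⁻) := by
      conv_lhs => rw [← CFC.posPart_sub_negPart Z hZ]
      rw [mul_sub]
      have := CFC.negPart_mul_posPart Z
      rw [CFC.posPart_sub_negPart Z hZ, this, zero_sub]
    rw [h1]
    conv_lhs => rw [hV]
    conv_rhs => rw [hV]
    noncomm_ring
  · have h2 : star V * V * (star V * V) = 0 := by rw [mul_assoc, h, mul_zero]
    have h3 : star V * V = 0 := by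
      rw [← CStarRing.star_mul_self_eq_zero_iff, hsa, h2]
    have h4 : Z⁻ = 0 := hV.trans h3
    have h5 : 0 ≤ Z := (CFC.negPart_eq_zero_iff Z hZ).1 h4
    exact CStarAlgebra.nonneg_iff_eq_star_mul_self.1 h5

variable {D : Type u} [CStarAlgebra D] {n : Type} [Fintype n]

def CStarRep.form (σ : CStarRep D) (X : Matrix n n D) (η ζ : n → σ.H) : ℂ :=
  ∑ i, ∑ j, ⟪η i, σ.π (X i j) (ζ j)⟫_ℂ

def CStarRep.act (σ : CStarRep D) (M : Matrix n n D) (η : n → σ.H) : n → σ.H :=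
  fun i => ∑ j, σ.π (M i j) (η j)

theorem CStarRep.form_mul (σ : CStarRep D) (X M : Matrix n n D) (η ζ : n → σ.H) :
    σ.form (X * M) η ζ = σ.form X η (σ.act M ζ) := by
  simp only [form, act, Matrix.mul_apply, map_sum, map_mul, sum_apply,
    inner_sum, mul_apply_eq_comp]
  refine Finset.sum_congr rfl fun i _ => Finset.sum_comm

theorem CStarRep.form_star_mul (σ : CStarRep D) (X M : Matrix n n D) (η ζ : n → σ.H) :
    σ.form (star M * X) η ζ = σ.form X (σ.act M η) ζ := by
  simp only [form, act, Matrix.mul_apply, map_sum, map_mul, sum_apply,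
    inner_sum, sum_inner, mul_apply_eq_comp, Matrix.star_apply, map_star,
    ContinuousLinearMap.star_eq_adjoint, ContinuousLinearMap.adjoint_inner_right]
  rw [Finset.sum_congr rfl fun i _ => Finset.sum_comm, Finset.sum_comm]
  exact Finset.sum_congr rfl fun i _ => Finset.sum_comm

theorem CStarRep.form_one [DecidableEq n] (σ : CStarRep D) (η ζ : n → σ.H) :
    σ.form 1 η ζ = ∑ i, ⟪η i, ζ i⟫_ℂ := by
  simp only [form]
  refine Finset.sum_congr rfl fun i _ => ?_
  rw [Finset.sum_eq_single i]
  · simp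
  · intro j _ hj
    simp [Matrix.one_apply_ne hj.symm]
  · simp

theorem CStarRep.form_star_mul_self [DecidableEq n] (σ : CStarRep D) (U : Matrix n n D) (η : n → σ.H) :
    σ.form (star U * U) η η = ((∑ i, ‖σ.act U η i‖ ^ 2 : ℝ) : ℂ) := by
  rw [form_star_mul, ← one_mul U, form_mul, form_one, one_mul]
  push_cast
  exact Finset.sum_congr rfl fun i _ => inner_self_eq_norm_sq_to_K _

theorem CStarRep.exists_eq_star_mul_self [DecidableEq n] {ι : Sort*} (F : ι → CStarRep D)
    (hF : ∀ d, (∀ i, (F i).π d = 0) → d = 0) (Z : Matrix n n D) (hZ : star Z = Z)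
    (hpos : ∀ i (η : n → (F i).H), 0 ≤ ((F i).form Z η η).re) :
    ∃ U : Matrix n n D, Z = star U * U := by
  let _ := CStarAlgebra.spectralOrder D
  let _ := CStarAlgebra.spectralOrderedRing D
  obtain ⟨V, h1, h2, h3⟩ := CStarAlgebra.exists_negPart (E := CStarMatrix n n D)
    (CStarMatrix.ofMatrix Z) (congrArg CStarMatrix.ofMatrix hZ)
  let V' : Matrix n n D := CStarMatrix.ofMatrix.symm V
  replace h1 : star (star V' * V') = star V' * V' := h1
  replace h2 : star V' * V' * Z * (star V' * V') =
    - (star (V' * (star V' * V')) * (V' * (star V' * V'))) := h2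
  have h4 : V' * (star V' * V') = 0 := by
    set N := V' * (star V' * V') with hN
    ext k j
    refine hF _ fun i => ?_
    ext η
    have h5 : (F i).form (star (star V' * V') * (Z * (star V' * V')))
        (Pi.single j η) (Pi.single j η) = (F i).form (- (star N * N)) (Pi.single j η)
          (Pi.single j η) := by
      rw [← h2, h1, mul_assoc (star V' * V') Z]
    have h6 : (F i).form (- (star N * N)) (Pi.single j η) (Pi.single j η) =
        - (F i).form (star N * N) (Pi.single j η) (Pi.single j η) := by
      simp [form]
    rw [form_star_mul, form_mul, h6, form_star_mul_self] at h5
    have h7 := hpos i ((F i).act (star V' * V') (Pi.single j η))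
    rw [h5] at h7
    have h8 : ∑ l, ‖(F i).act N (Pi.single j η) l‖ ^ 2 ≤ 0 := by
      have : (-((∑ l, ‖(F i).act N (Pi.single j η) l‖ ^ 2 : ℝ) : ℂ)).re =
        - ∑ l, ‖(F i).act N (Pi.single j η) l‖ ^ 2 := by
        rw [Complex.neg_re, Complex.ofReal_re]
      rw [this] at h7
      linarith
    have h9 := (Finset.sum_eq_zero_iff_of_nonneg (fun l _ => sq_nonneg _)).1
      (le_antisymm h8 (Finset.sum_nonneg fun l _ => sq_nonneg _)) k (Finset.mem_univ k)
    have h10 : (F i).act N (Pi.single j η) k = 0 := by simpa using h9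
    have h11 : (F i).act N (Pi.single j η) k = (F i).π (N k j) η := by
      rw [act, Finset.sum_eq_single j]
      · simp
      · intro l _ hl; simp [Pi.single_eq_of_ne hl]
      · simp
    rw [← h11, h10]
    simp
  obtain ⟨U, hU⟩ := h3 h4
  exact ⟨CStarMatrix.ofMatrix.symm U, hU⟩

theorem exists_sum_tmul {M N : Type*} [AddCommGroup M] [AddCommGroup N] [Module ℂ M] [Module ℂ N]
    (x : M ⊗[ℂ] N) : ∃ (m : ℕ) (a : Fin m → M) (b : Fin m → N), x = ∑ i, a i ⊗ₜ[ℂ] b i := by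
  obtain ⟨s, hs⟩ := TensorProduct.exists_finset x
  refine ⟨s.card, fun i => (s.equivFin.symm i).1.1, fun i => (s.equivFin.symm i).1.2, ?_⟩
  rw [hs, ← Finset.sum_coe_sort]
  exact (Equiv.sum_comp s.equivFin.symm (fun p => p.1.1 ⊗ₜ[ℂ] p.1.2)).symm

/-- The norm may be computed with a separating family of representations of one factor. -/
theorem AlgTensor.norm_rep_le_of_separating {A : Type u} [CStarAlgebra A] {ι : Sort*}
    (F : ι → CStarRep D) (hF : ∀ d, (∀ i, (F i).π d = 0) → d = 0) (ρ : CStarRep A)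
    (x : AlgTensor A D) {C : ℝ} (hC : 0 ≤ C) (h : ∀ i, ‖AlgTensor.rep ρ (F i) x‖ ≤ C)
    (σ : CStarRep D) : ‖AlgTensor.rep ρ σ x‖ ≤ C := by
  obtain ⟨m, a, d, rfl⟩ : ∃ (m : ℕ) (a : Fin m → A) (d : Fin m → D),
      x = ∑ k, AlgTensor.tmul (a k) (d k) := exists_sum_tmul x
  refine ContinuousLinearMap.opNorm_le_bound _ hC fun ξ => ?_
  induction ξ using HilbertTensor.induction_on with
  | hp => apply isClosed_le <;> fun_prop
  | ih ξ =>
  obtain ⟨n, e, η, rfl⟩ := exists_sum_tmul ξ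
  let Z : Matrix (Fin n) (Fin n) D := fun i j =>
    ((C : ℂ) ^ 2 * ⟪e i, e j⟫_ℂ) • 1 -
      ∑ k, ∑ l, ⟪ρ.π (a k) (e i), ρ.π (a l) (e j)⟫_ℂ • (star (d k) * d l)
  have hform : ∀ (τ : CStarRep D) (θ : Fin n → τ.H), τ.form Z θ θ =
      ((C ^ 2 * ‖HilbertTensor.of (∑ j, e j ⊗ₜ[ℂ] θ j)‖ ^ 2 -
        ‖AlgTensor.rep ρ τ (∑ k, AlgTensor.tmul (a k) (d k))
          (HilbertTensor.of (∑ j, e j ⊗ₜ[ℂ] θ j))‖ ^ 2 : ℝ) : ℂ) := by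
    intro τ θ
    have h1 : AlgTensor.rep ρ τ (∑ k, AlgTensor.tmul (a k) (d k))
        (HilbertTensor.of (∑ j, e j ⊗ₜ[ℂ] θ j)) =
        HilbertTensor.of (∑ k, ∑ j, ρ.π (a k) (e j) ⊗ₜ[ℂ] τ.π (d k) (θ j)) := by
      simp only [map_sum, sum_apply, AlgTensor.rep_tmul, opTensor_of]
      rw [Finset.sum_comm]
      rfl
    have h2 : ∀ y : ρ.H ⊗[ℂ] τ.H, ((‖y‖ ^ 2 : ℝ) : ℂ) = ⟪y, y⟫_ℂ := fun y => by
      rw [Complex.ofReal_pow]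
      exact (inner_self_eq_norm_sq_to_K (𝕜 := ℂ) y).symm
    rw [h1, LinearIsometry.norm_map, LinearIsometry.norm_map, Complex.ofReal_sub,
      Complex.ofReal_mul, h2, h2]
    simp only [CStarRep.form, Z, map_sub, map_sum, map_smul, map_one, map_mul, map_star,
      sub_apply, sum_apply, smul_apply, inner_sub_right, inner_sum, sum_inner, inner_smul_right,
      one_apply_eq_self, mul_apply_eq_comp, ContinuousLinearMap.star_eq_adjoint,
      ContinuousLinearMap.adjoint_inner_right, TensorProduct.inner_tmul, Finset.sum_sub_distrib,
      Finset.mul_sum]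
    congr 1
    · rw [Finset.sum_comm]
      exact Finset.sum_congr rfl fun _ _ => Finset.sum_congr rfl fun _ _ => by
        rw [Complex.ofReal_pow, mul_assoc]
    · calc _ = _ := Finset.sum_congr rfl fun _ _ => Finset.sum_congr rfl fun _ _ =>
            Finset.sum_comm
        _ = _ := Finset.sum_congr rfl fun _ _ => Finset.sum_comm
        _ = _ := Finset.sum_comm
        _ = _ := Finset.sum_congr rfl fun _ _ => Finset.sum_comm
        _ = _ := Finset.sum_congr rfl fun _ _ => Finset.sum_congr rfl fun _ _ =>
            Finset.sum_comm
  have hZ : star Z = Z := by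
    ext i j
    rw [Matrix.star_apply]
    simp only [Z, star_sub, star_smul, star_sum, star_mul, star_star, star_one, star_pow,
      RCLike.star_def, Complex.conj_ofReal, inner_conj_symm]
    rw [Finset.sum_comm, mul_comm]
  obtain ⟨U, hU⟩ := CStarRep.exists_eq_star_mul_self F hF Z hZ (fun i θ => by
    rw [hform, Complex.ofReal_re, sub_nonneg, ← mul_pow]
    refine pow_le_pow_left₀ (norm_nonneg _) ?_ 2
    exact (ContinuousLinearMap.le_opNorm _ _).trans
      (mul_le_mul_of_nonneg_right (h i) (norm_nonneg _)))
  have h1 := hform σ η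
  rw [hU, CStarRep.form_star_mul_self, Complex.ofReal_inj] at h1
  have h2 : 0 ≤ ∑ i, ‖σ.act U η i‖ ^ 2 := Finset.sum_nonneg fun l _ => sq_nonneg _
  rw [h1, sub_nonneg, ← mul_pow] at h2
  exact le_of_sq_le_sq h2 (mul_nonneg hC (norm_nonneg _))

end Amplification

section Assoc

section

variable {H K L : Type*} [NormedAddCommGroup H] [InnerProductSpace ℂ H] [CompleteSpace H]
  [NormedAddCommGroup K] [InnerProductSpace ℂ K] [CompleteSpace K]
  [NormedAddCommGroup L] [InnerProductSpace ℂ L] [CompleteSpace L]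

variable (H K L) in
def HilbertTensor.inner₁ : (H ⊗[ℂ] K) ⊗[ℂ] L →ₗᵢ[ℂ] HilbertTensor (HilbertTensor H K) L :=
  HilbertTensor.of.comp (TensorProduct.mapIsometry HilbertTensor.of LinearIsometry.id)

variable (H K L) in
def HilbertTensor.inner₂ : H ⊗[ℂ] (K ⊗[ℂ] L) →ₗᵢ[ℂ] HilbertTensor H (HilbertTensor K L) :=
  HilbertTensor.of.comp (TensorProduct.mapIsometry LinearIsometry.id HilbertTensor.of)

theorem HilbertTensor.dense_inner₂ : DenseRange (HilbertTensor.inner₂ H K L) := by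
  let S : Submodule ℂ (HilbertTensor H (HilbertTensor K L)) :=
    (LinearMap.range (HilbertTensor.inner₂ H K L).toLinearMap).topologicalClosure
  have hS : IsClosed (S : Set (HilbertTensor H (HilbertTensor K L))) :=
    Submodule.isClosed_topologicalClosure _
  have h : ∀ x, x ∈ S := by
    intro x
    induction x using HilbertTensor.induction_on with
    | hp => exact hS
    | ih x =>
      induction x with
      | zero => rw [map_zero]; exact S.zero_mem
      | add x y hx hy => rw [map_add]; exact S.add_mem hx hy
      | tmul h ω =>
        have hc : Continuous fun ω : HilbertTensor K L => HilbertTensor.of (h ⊗ₜ[ℂ] ω) :=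
          HilbertTensor.of.continuous.comp (TensorProduct.mkL ℂ H (HilbertTensor K L) h).continuous
        induction ω using HilbertTensor.induction_on with
        | hp => exact hS.preimage hc
        | ih ω => exact Submodule.le_topologicalClosure _ ⟨h ⊗ₜ[ℂ] ω, rfl⟩
  intro x
  exact h x

variable (H K L) in
def HilbertTensor.assoc' : HilbertTensor H (HilbertTensor K L) →L[ℂ]
    HilbertTensor (HilbertTensor H K) L :=
  ((HilbertTensor.inner₁ H K L).toLinearMap.comp
    (TensorProduct.assoc ℂ H K L).symm.toLinearMap).extendOfNorm
    (HilbertTensor.inner₂ H K L).toLinearMap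

theorem HilbertTensor.assoc'_inner₂ (x : H ⊗[ℂ] (K ⊗[ℂ] L)) :
    HilbertTensor.assoc' H K L (HilbertTensor.inner₂ H K L x) =
      HilbertTensor.inner₁ H K L ((TensorProduct.assoc ℂ H K L).symm x) :=
  LinearMap.extendOfNorm_eq HilbertTensor.dense_inner₂ ⟨1, fun x => by
    rw [one_mul]
    refine le_of_eq ?_
    exact ((HilbertTensor.inner₁ H K L).norm_map _).trans
      (((TensorProduct.assocIsometry ℂ H K L).symm.norm_map x).trans
        ((HilbertTensor.inner₂ H K L).norm_map x).symm)⟩ x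

theorem HilbertTensor.norm_assoc' (x : HilbertTensor H (HilbertTensor K L)) :
    ‖HilbertTensor.assoc' H K L x‖ = ‖x‖ := by
  refine HilbertTensor.dense_inner₂.induction_on x (isClosed_eq (by fun_prop) (by fun_prop))
    fun x => ?_
  rw [assoc'_inner₂, LinearIsometry.norm_map, LinearIsometry.norm_map]
  exact (TensorProduct.assocIsometry ℂ H K L).symm.norm_map x

theorem HilbertTensor.assoc'_opTensor (S : H →L[ℂ] H) (T : K →L[ℂ] K) (U : L →L[ℂ] L)
    (x : HilbertTensor H (HilbertTensor K L)) :
    HilbertTensor.assoc' H K L (opTensor S (opTensor T U) x) =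
      opTensor (opTensor S T) U (HilbertTensor.assoc' H K L x) := by
  refine HilbertTensor.dense_inner₂.induction_on x (isClosed_eq (by fun_prop) (by fun_prop))
    fun x => ?_
  have h2 : opTensor S (opTensor T U) (HilbertTensor.inner₂ H K L x) =
      HilbertTensor.inner₂ H K L (TensorProduct.map S.toLinearMap
        (TensorProduct.map T.toLinearMap U.toLinearMap) x) := by
    refine (opTensor_of _ _ _).trans (congrArg HilbertTensor.of ?_)
    induction x with
    | zero => simp
    | add x y hx hy => simp only [map_add, hx, hy]
    | tmul h y => exact congrArg (fun z => S h ⊗ₜ[ℂ] z) (opTensor_of T U y)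
  have h1 : ∀ x, opTensor (opTensor S T) U (HilbertTensor.inner₁ H K L x) =
      HilbertTensor.inner₁ H K L (TensorProduct.map
        (TensorProduct.map S.toLinearMap T.toLinearMap) U.toLinearMap x) := by
    intro x
    refine (opTensor_of _ _ _).trans (congrArg HilbertTensor.of ?_)
    induction x with
    | zero => simp
    | add x y hx hy => simp only [map_add, hx, hy]
    | tmul y l => exact congrArg (fun z => z ⊗ₜ[ℂ] U l) (opTensor_of S T y)
  rw [h2, assoc'_inner₂, assoc'_inner₂, h1, TensorProduct.map_map_assoc_symm]

end

variable {A B C : Type u} [CStarAlgebra A] [CStarAlgebra B] [CStarAlgebra C]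

theorem MinTensor.norm_le_of_separating {ι : Sort*} (F : ι → CStarRep B)
    (hF : ∀ b, (∀ i, (F i).π b = 0) → b = 0) {x : MinTensor A B} {C : ℝ} (hC : 0 ≤ C)
    (h : ∀ (ρ : CStarRep A) i, ‖MinTensor.rep ρ (F i) x‖ ≤ C) : ‖x‖ ≤ C := by
  refine le_of_forall_pos_le_add fun ε hε => ?_
  have hd : DenseRange (MinTensor.ofAlg : AlgTensor A B → MinTensor A B) :=
    UniformSpace.Completion.denseRange_coe
  obtain ⟨y, hy⟩ := hd.exists_dist_lt x (half_pos hε)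
  rw [dist_eq_norm] at hy
  have h1 : ‖y‖ ≤ C + ε / 2 := AlgTensor.minNorm_le fun ρ σ => by
    refine AlgTensor.norm_rep_le_of_separating F hF ρ y (by positivity) (fun i => ?_) σ
    rw [← MinTensor.rep_ofAlg]
    have h2 : MinTensor.rep ρ (F i) (MinTensor.ofAlg y) =
        MinTensor.rep ρ (F i) x - MinTensor.rep ρ (F i) (x - MinTensor.ofAlg y) := by
      rw [map_sub]; abel
    rw [h2]
    exact (norm_sub_le _ _).trans (add_le_add (h ρ i) ((norm_rep_le ρ (F i) _).trans hy.le))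
  have h3 : ‖x‖ ≤ ‖x - MinTensor.ofAlg y‖ + ‖MinTensor.ofAlg y‖ := by
    simpa using norm_add_le (x - MinTensor.ofAlg y) (MinTensor.ofAlg y)
  rw [MinTensor.norm_ofAlg] at h3
  linarith

def CStarRep.tensor (ρ : CStarRep A) (σ : CStarRep B) : CStarRep (MinTensor A B) where
  H := HilbertTensor ρ.H σ.H
  π := MinTensor.rep ρ σ

theorem CStarRep.tensor_separating (x : MinTensor A B)
    (h : ∀ p : CStarRep A × CStarRep B, (p.1.tensor p.2).π x = 0) : x = 0 := by
  rw [← norm_le_zero_iff]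
  refine MinTensor.norm_le_of_rep fun ρ σ => ?_
  have : MinTensor.rep ρ σ x = 0 := h (ρ, σ)
  rw [this, norm_zero]

variable (A B C) in
def MinTensor.assocLeft : MinTensor A B →⋆ₐ[ℂ] MinTensor A (MinTensor B C) :=
  MinTensor.map (StarAlgHom.id ℂ A) MinTensor.includeLeft

variable (A B C) in
def MinTensor.assocRight : C →⋆ₐ[ℂ] MinTensor A (MinTensor B C) :=
  MinTensor.includeRight.comp MinTensor.includeRight

theorem MinTensor.assocLeft_tmul (a : A) (b : B) :
    MinTensor.assocLeft A B C (MinTensor.tmul a b) = MinTensor.tmul a (MinTensor.tmul b 1) :=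
  MinTensor.map_tmul _ _ _ _

theorem MinTensor.assocRight_apply (c : C) :
    MinTensor.assocRight A B C c = MinTensor.tmul 1 (MinTensor.tmul 1 c) := rfl

theorem MinTensor.commute_assoc (u : MinTensor A B) (c : C) :
    Commute (MinTensor.assocLeft A B C u) (MinTensor.assocRight A B C c) := by
  have h := map_continuous (MinTensor.assocLeft A B C)
  rw [commute_iff_eq]
  refine MinTensor.induction_on u (isClosed_eq (by fun_prop) (by fun_prop)) fun u => ?_
  induction u using AlgTensor.induction_on with
  | tmul a b =>
    change MinTensor.assocLeft A B C (MinTensor.tmul a b) * _ =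
      _ * MinTensor.assocLeft A B C (MinTensor.tmul a b)
    simp only [assocLeft_tmul, assocRight_apply, tmul_mul_tmul, one_mul, mul_one]
  | add x y hx hy => rw [map_add, map_add, mul_add, add_mul, hx, hy]

variable (A B C) in
def MinTensor.assocAlg : AlgTensor (MinTensor A B) C →⋆ₐ[ℂ] MinTensor A (MinTensor B C) :=
  AlgTensor.lift (MinTensor.assocLeft A B C) (MinTensor.assocRight A B C) MinTensor.commute_assoc

theorem MinTensor.assocAlg_tmul (u : MinTensor A B) (c : C) :
    MinTensor.assocAlg A B C (AlgTensor.tmul u c) =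
      MinTensor.assocLeft A B C u * MinTensor.assocRight A B C c :=
  AlgTensor.lift_tmul _ _ MinTensor.commute_assoc u c

theorem MinTensor.rep_assocAlg (ρ : CStarRep A) (σ : CStarRep B) (τ : CStarRep C)
    (x : AlgTensor (MinTensor A B) C) (ξ : HilbertTensor ρ.H (HilbertTensor σ.H τ.H)) :
    HilbertTensor.assoc' ρ.H σ.H τ.H
      (MinTensor.rep ρ (σ.tensor τ) (MinTensor.assocAlg A B C x) ξ) =
      AlgTensor.rep (ρ.tensor σ) τ x (HilbertTensor.assoc' ρ.H σ.H τ.H ξ) := by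
  let r : MinTensor A (MinTensor B C) →⋆ₐ[ℂ]
      (HilbertTensor ρ.H (HilbertTensor σ.H τ.H) →L[ℂ] HilbertTensor ρ.H (HilbertTensor σ.H τ.H)) :=
    MinTensor.rep ρ (σ.tensor τ)
  let s : AlgTensor (MinTensor A B) C →⋆ₐ[ℂ]
      (HilbertTensor (HilbertTensor ρ.H σ.H) τ.H →L[ℂ] HilbertTensor (HilbertTensor ρ.H σ.H) τ.H) :=
    AlgTensor.rep (ρ.tensor σ) τ
  change HilbertTensor.assoc' ρ.H σ.H τ.H (r (MinTensor.assocAlg A B C x) ξ) =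
    s x (HilbertTensor.assoc' ρ.H σ.H τ.H ξ)
  induction x using AlgTensor.induction_on with
  | add x y hx hy =>
    rw [map_add, map_add, map_add, add_apply, add_apply, map_add, hx, hy]
  | tmul u c =>
    have hs : ∀ u : MinTensor A B, s (AlgTensor.tmul u c) =
        opTensorₗ (MinTensor.rep ρ σ u) (τ.π c) := fun u => rfl
    simp only [hs]
    have h1 := map_continuous r
    have h2 := map_continuous (MinTensor.assocLeft A B C)
    have h3 := map_continuous (MinTensor.rep ρ σ)
    have h4 : Continuous fun S : HilbertTensor ρ.H σ.H →L[ℂ] HilbertTensor ρ.H σ.H =>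
        opTensorₗ S (τ.π c) := by
      refine (LinearMap.mkContinuous (opTensorₗ.flip (τ.π c)) ‖τ.π c‖ fun S => ?_).continuous
      rw [mul_comm]
      exact norm_opTensor_le _ _
    have h5 := h4.comp h3
    simp only [Function.comp_def] at h5
    simp only [assocAlg_tmul]
    refine MinTensor.induction_on u (isClosed_eq (by fun_prop) (by fun_prop)) fun u => ?_
    induction u using AlgTensor.induction_on with
    | add x y hx hy =>
      simp only [map_add, add_mul, add_apply, hx, hy, LinearMap.add_apply]
    | tmul a b =>
      change HilbertTensor.assoc' ρ.H σ.H τ.H (r (MinTensor.assocLeft A B C (MinTensor.tmul a b) *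
        _) ξ) = opTensor (MinTensor.rep ρ σ (MinTensor.tmul a b)) (τ.π c) _
      rw [assocLeft_tmul, assocRight_apply, tmul_mul_tmul, tmul_mul_tmul, mul_one, mul_one,
        one_mul]
      have h6 : r (MinTensor.tmul a (MinTensor.tmul b c)) =
          opTensor (ρ.π a) (opTensor (σ.π b) (τ.π c)) := by
        refine (MinTensor.rep_tmul ρ (σ.tensor τ) a (MinTensor.tmul b c)).trans ?_
        exact congrArg (opTensor (ρ.π a)) (MinTensor.rep_tmul σ τ b c)
      rw [h6, MinTensor.rep_tmul]
      exact HilbertTensor.assoc'_opTensor _ _ _ _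

theorem MinTensor.norm_assocAlg_le (x : AlgTensor (MinTensor A B) C) :
    ‖MinTensor.assocAlg A B C x‖ ≤ ‖x‖ := by
  refine MinTensor.norm_le_of_separating
    (fun p : CStarRep B × CStarRep C => p.1.tensor p.2) CStarRep.tensor_separating (norm_nonneg _)
    fun ρ p => ?_
  refine ContinuousLinearMap.opNorm_le_bound _ (norm_nonneg _)
    fun (ξ : HilbertTensor ρ.H (HilbertTensor p.1.H p.2.H)) => ?_
  have h1 := (AlgTensor.rep (ρ.tensor p.1) p.2 x).le_opNorm
    (HilbertTensor.assoc' ρ.H p.1.H p.2.H ξ)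
  have h2 := HilbertTensor.norm_assoc' (H := ρ.H) (K := p.1.H) (L := p.2.H)
    (MinTensor.rep ρ (p.1.tensor p.2) (MinTensor.assocAlg A B C x) ξ)
  rw [← MinTensor.rep_assocAlg] at h1
  refine h2.symm.trans_le (h1.trans ?_)
  refine mul_le_mul (AlgTensor.norm_rep_le _ _ x) ?_ (norm_nonneg _) (norm_nonneg _)
  exact (HilbertTensor.norm_assoc' ξ).le

variable (A B C) in
/-- The associativity isomorphism `(A ⊗ B) ⊗ C → A ⊗ (B ⊗ C)`. -/
def MinTensor.assoc : MinTensor (MinTensor A B) C →⋆ₐ[ℂ] MinTensor A (MinTensor B C) :=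
  MinTensor.extend (MinTensor.assocAlg A B C) MinTensor.norm_assocAlg_le

theorem MinTensor.assoc_tmul (a : A) (b : B) (c : C) :
    MinTensor.assoc A B C (MinTensor.tmul (MinTensor.tmul a b) c) =
      MinTensor.tmul a (MinTensor.tmul b c) := by
  refine (MinTensor.extend_ofAlg _ MinTensor.norm_assocAlg_le _).trans ?_
  rw [assocAlg_tmul, assocLeft_tmul, assocRight_apply, tmul_mul_tmul, tmul_mul_tmul, mul_one,
    mul_one, one_mul]

end Assoc

/-! ### Rearrangements of tensor factors -/

section Rearrange

variable (A B C D : Type u) [CStarAlgebra A] [CStarAlgebra B] [CStarAlgebra C] [CStarAlgebra D]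

/-- The inverse associativity isomorphism `A ⊗ (B ⊗ C) → (A ⊗ B) ⊗ C`, written through flips. -/
def MinTensor.assocInv : MinTensor A (MinTensor B C) →⋆ₐ[ℂ] MinTensor (MinTensor A B) C :=
  (MinTensor.map (MinTensor.comm B A) (StarAlgHom.id ℂ C)).comp <|
    (MinTensor.comm C (MinTensor B A)).comp <|
      (MinTensor.assoc C B A).comp <|
        (MinTensor.map (MinTensor.comm B C) (StarAlgHom.id ℂ A)).comp <|
          MinTensor.comm A (MinTensor B C)

/-- The isomorphism `(A ⊗ B) ⊗ (C ⊗ D) → (A ⊗ C) ⊗ (B ⊗ D)` exchanging the two middle factors. -/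
def MinTensor.interchange :
    MinTensor (MinTensor A B) (MinTensor C D) →⋆ₐ[ℂ] MinTensor (MinTensor A C) (MinTensor B D) :=
  (MinTensor.assocInv A C (MinTensor B D)).comp <|
    (MinTensor.map (StarAlgHom.id ℂ A) ((MinTensor.assoc C B D).comp <|
      (MinTensor.map (MinTensor.comm B C) (StarAlgHom.id ℂ D)).comp <|
        MinTensor.assocInv B C D)).comp <|
      MinTensor.assoc A B (MinTensor C D)

variable {A B C D}

theorem MinTensor.assocInv_tmul (a : A) (b : B) (c : C) :
    MinTensor.assocInv A B C (MinTensor.tmul a (MinTensor.tmul b c)) =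
      MinTensor.tmul (MinTensor.tmul a b) c := by
  simp [assocInv, comm_tmul, map_tmul, assoc_tmul]

theorem MinTensor.interchange_tmul (a : A) (b : B) (c : C) (d : D) :
    MinTensor.interchange A B C D (MinTensor.tmul (MinTensor.tmul a b) (MinTensor.tmul c d)) =
      MinTensor.tmul (MinTensor.tmul a c) (MinTensor.tmul b d) := by
  simp [interchange, comm_tmul, map_tmul, assoc_tmul, assocInv_tmul]

/-- Leg numbering: `X ↦ X₁₂` from `A ⊗ B` to `(A ⊗ B) ⊗ C`, `X₁₂ = X ⊗ 1`. -/
def MinTensor.leg₁₂ : MinTensor A B →⋆ₐ[ℂ] MinTensor (MinTensor A B) C :=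
  MinTensor.includeLeft

/-- Leg numbering: `X ↦ X₁₃` from `A ⊗ C` to `(A ⊗ B) ⊗ C`, `(a ⊗ c)₁₃ = (a ⊗ 1) ⊗ c`. -/
def MinTensor.leg₁₃ : MinTensor A C →⋆ₐ[ℂ] MinTensor (MinTensor A B) C :=
  MinTensor.map MinTensor.includeLeft (StarAlgHom.id ℂ C)

/-- Leg numbering: `X ↦ X₂₃` from `B ⊗ C` to `(A ⊗ B) ⊗ C`, `(b ⊗ c)₂₃ = (1 ⊗ b) ⊗ c`. -/
def MinTensor.leg₂₃ : MinTensor B C →⋆ₐ[ℂ] MinTensor (MinTensor A B) C :=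
  MinTensor.map MinTensor.includeRight (StarAlgHom.id ℂ C)

/-- For `f : D → A ⊗ B`, the opposite map `f^op = τ ∘ f : D → B ⊗ A`, `τ` the flip. -/
def opHom (f : D →⋆ₐ[ℂ] MinTensor A B) : D →⋆ₐ[ℂ] MinTensor B A :=
  (MinTensor.comm A B).comp f

end Rearrange

/-! ### Tensor powers -/

section Powers

/-- A bundled unital C⋆-algebra, used only for the recursion defining tensor powers. -/
structure BundledCStarAlgebra : Type (u + 1) where
  carrier : Type u
  [str : CStarAlgebra carrier]

attribute [instance] BundledCStarAlgebra.str

/-- The iterated tensor product underlying `TPow`. -/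
def tensorPowBundled (A : Type u) [CStarAlgebra A] : ℕ → BundledCStarAlgebra.{u}
  | 0 => ⟨A⟩
  | k + 1 => ⟨MinTensor (tensorPowBundled A k).carrier A⟩

/-- `TPow A k` is the tensor power `A^{⊗(k+1)}` with `k + 1 ≥ 1` factors:
`A^{⊗1} = A` and `A^{⊗(k+2)} = A^{⊗(k+1)} ⊗ A`. -/
def TPow (A : Type u) [CStarAlgebra A] (k : ℕ) : Type u := (tensorPowBundled A k).carrier

instance (A : Type u) [CStarAlgebra A] (k : ℕ) : CStarAlgebra (TPow A k) :=
  (tensorPowBundled A k).str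

variable {A B C : Type u} [CStarAlgebra A] [CStarAlgebra B] [CStarAlgebra C]

/-- The elementary tensor `x₀ ⊗ ⋯ ⊗ x_k` in `A^{⊗(k+1)}`. -/
def TPow.tprod : (k : ℕ) → (Fin (k + 1) → A) → TPow A k
  | 0, x => x 0
  | k + 1, x => (MinTensor.tmul (TPow.tprod k fun i => x i.castSucc) (x (Fin.last (k + 1))) :
      MinTensor (TPow A k) A)

/-- `f^{⊗(k+1)}` for a unital `⋆`-homomorphism `f`. -/
def TPow.map (f : A →⋆ₐ[ℂ] B) : (k : ℕ) → TPow A k →⋆ₐ[ℂ] TPow B k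
  | 0 => f
  | k + 1 => (MinTensor.map (TPow.map f k) f : MinTensor (TPow A k) A →⋆ₐ[ℂ] MinTensor (TPow B k) B)

variable (A B) in
/-- The map `T : (A ⊗ B)^{⊗n} → A^{⊗n} ⊗ B^{⊗n}`, `n = k + 1`, which sorts the tensor factors;
its values on elementary tensors are computed in `TPow.shuffle_tprod`. -/
def TPow.shuffle : (k : ℕ) → TPow (MinTensor A B) k →⋆ₐ[ℂ] MinTensor (TPow A k) (TPow B k)
  | 0 => StarAlgHom.id ℂ (MinTensor A B)
  | k + 1 =>
    ((MinTensor.interchange (TPow A k) (TPow B k) A B).comp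
      (MinTensor.map (TPow.shuffle k) (StarAlgHom.id ℂ (MinTensor A B))) :
      MinTensor (TPow (MinTensor A B) k) (MinTensor A B) →⋆ₐ[ℂ]
        MinTensor (MinTensor (TPow A k) A) (MinTensor (TPow B k) B))

theorem TPow.map_tprod (f : A →⋆ₐ[ℂ] B) (k : ℕ) (x : Fin (k + 1) → A) :
    TPow.map f k (TPow.tprod k x) = TPow.tprod k fun i => f (x i) := by
  induction k with
  | zero => rfl
  | succ k ih =>
    refine (MinTensor.map_tmul (TPow.map f k) f _ _).trans ?_
    rw [ih]
    rfl

/-- `T (x₁ ⊗ y₁ ⊗ ⋯ ⊗ xₙ ⊗ yₙ) = (x₁ ⊗ ⋯ ⊗ xₙ) ⊗ (y₁ ⊗ ⋯ ⊗ yₙ)`. -/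
theorem TPow.shuffle_tprod (k : ℕ) (x : Fin (k + 1) → A) (y : Fin (k + 1) → B) :
    TPow.shuffle A B k (TPow.tprod k fun i => MinTensor.tmul (x i) (y i)) =
      MinTensor.tmul (TPow.tprod k x) (TPow.tprod k y) := by
  induction k with
  | zero => rfl
  | succ k ih =>
    refine (congrArg (MinTensor.interchange (TPow A k) (TPow B k) A B)
      (MinTensor.map_tmul (TPow.shuffle A B k) (StarAlgHom.id ℂ _) _ _)).trans ?_
    rw [ih]
    exact MinTensor.interchange_tmul _ _ _ _

/-- For `f : C → A ⊗ B`, the componentwise power `f^{(n)} = T ∘ f^{⊗n} : C^{⊗n} → A^{⊗n} ⊗ B^{⊗n}`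
with `n = k + 1`. -/
def compPow (k : ℕ) (f : C →⋆ₐ[ℂ] MinTensor A B) :
    TPow C k →⋆ₐ[ℂ] MinTensor (TPow A k) (TPow B k) :=
  (TPow.shuffle A B k).comp (TPow.map f k)

/-- For `R ∈ A ⊗ B`, the element `T (R^{⊗n}) ∈ A^{⊗n} ⊗ B^{⊗n}` with `n = k + 1`. -/
def compPowElem (k : ℕ) (R : MinTensor A B) : MinTensor (TPow A k) (TPow B k) :=
  TPow.shuffle A B k (TPow.tprod k fun _ => R)

end Powers

/-! ### C⋆-weakly coassociative systems -/

section WCS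

/-- A unital C⋆-algebra `B` with a unital `⋆`-homomorphism `Δ : B → B ⊗ B` is a C⋆-bialgebra if
`(Δ ⊗ id) ∘ Δ = (id ⊗ Δ) ∘ Δ`. (As `B` is unital, morphisms from `B` to `B ⊗ B` are the unital
`⋆`-homomorphisms into `M(B ⊗ B) = B ⊗ B`.) -/
def IsCStarBialgebra {B : Type u} [CStarAlgebra B] (Δ : B →⋆ₐ[ℂ] MinTensor B B) : Prop :=
  ∀ x, MinTensor.assoc B B B (MinTensor.map Δ (StarAlgHom.id ℂ B) (Δ x)) =
    MinTensor.map (StarAlgHom.id ℂ B) Δ (Δ x)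

/-- `ε : B → ℂ` is a counit of `Δ`: `(ε ⊗ id) ∘ Δ = id = (id ⊗ ε) ∘ Δ`. Here `l` and `r` are the
`⋆`-homomorphisms `ε ⊗ id` and `id ⊗ ε` with `ℂ ⊗ B` and `B ⊗ ℂ` identified with `B`; they are
determined by their values on elementary tensors. -/
def IsCounit {B : Type u} [CStarAlgebra B] (Δ : B →⋆ₐ[ℂ] MinTensor B B) (ε : B →⋆ₙₐ[ℂ] ℂ) : Prop :=
  (∃ l : MinTensor B B →⋆ₙₐ[ℂ] B,
    (∀ a b, l (MinTensor.tmul a b) = ε a • b) ∧ ∀ x, l (Δ x) = x) ∧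
  (∃ r : MinTensor B B →⋆ₙₐ[ℂ] B,
    (∀ a b, r (MinTensor.tmul a b) = ε b • a) ∧ ∀ x, r (Δ x) = x)

/-- The identity map `A a → A b` for equal indices `a = b`. -/
def castHom {S : Type*} (A : S → Type u) [∀ a, CStarAlgebra (A a)] :
    {a b : S} → a = b → (A a →⋆ₐ[ℂ] A b)
  | a, _, rfl => StarAlgHom.id ℂ (A a)

/-- `{(A_a, φ_{a,b})}` is a C⋆-weakly coassociative system over the monoid `S`. -/
structure IsCStarWCS {S : Type*} [Monoid S] (A : S → Type u) [∀ a, CStarAlgebra (A a)]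
    (φ : ∀ a b, A (a * b) →⋆ₐ[ℂ] MinTensor (A a) (A b)) : Prop where
  /-- `(id_a ⊗ φ_{b,c}) ∘ φ_{a,bc} = (φ_{a,b} ⊗ id_c) ∘ φ_{ab,c}` -/
  coassoc : ∀ (a b c : S) (x : A (a * b * c)),
    MinTensor.map (StarAlgHom.id ℂ (A a)) (φ b c) (φ a (b * c) (castHom A (mul_assoc a b c) x)) =
      MinTensor.assoc (A a) (A b) (A c)
        (MinTensor.map (φ a b) (StarAlgHom.id ℂ (A c)) (φ (a * b) c x))
  /-- `(A_e, φ_{e,e})` is a C⋆-bialgebra -/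
  bialgebra_one : IsCStarBialgebra ((φ 1 1).comp (castHom A (mul_one 1).symm))
  /-- and has a counit -/
  exists_counit : ∃ ε : A 1 →⋆ₙₐ[ℂ] ℂ, IsCounit ((φ 1 1).comp (castHom A (mul_one 1).symm)) ε
  /-- `φ_{e,a}(x) = I_e ⊗ x` -/
  one_left : ∀ (a : S) (x : A a), φ 1 a (castHom A (one_mul a).symm x) = MinTensor.tmul 1 x
  /-- `φ_{a,e}(x) = x ⊗ I_e` -/
  one_right : ∀ (a : S) (x : A a), φ a 1 (castHom A (mul_one a).symm x) = MinTensor.tmul x 1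

/-- `{(A_a, φ_{a,b}, R^{(a,b)})}` is a locally quasi-cocommutative C⋆-WCS over the commutative
monoid `S` (commutativity gives `A_{ab} = A_{ba}`, the common domain of `φ_{a,b}` and
`φ_{b,a}^op`). -/
structure IsLocallyQuasiCocommutative {S : Type*} [CommMonoid S] (A : S → Type u)
    [∀ a, CStarAlgebra (A a)] (φ : ∀ a b, A (a * b) →⋆ₐ[ℂ] MinTensor (A a) (A b))
    (R : ∀ a b, MinTensor (A a) (A b)) : Prop where
  wcs : IsCStarWCS A φ
  unitary_mem : ∀ a b, R a b ∈ unitary (MinTensor (A a) (A b))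
  /-- `R^{(a,b)} φ_{a,b}(x) (R^{(a,b)})^* = φ_{b,a}^op(x)` -/
  conj_eq_op : ∀ (a b : S) (x : A (a * b)),
    R a b * φ a b x * star (R a b) = opHom (φ b a) (castHom A (mul_comm a b) x)

/-- Local quasi-triangularity of a locally quasi-cocommutative C⋆-WCS. -/
structure IsLocallyQuasiTriangular {S : Type*} [CommMonoid S] (A : S → Type u)
    [∀ a, CStarAlgebra (A a)] (φ : ∀ a b, A (a * b) →⋆ₐ[ℂ] MinTensor (A a) (A b))
    (R : ∀ a b, MinTensor (A a) (A b)) : Prop where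
  quasiCocommutative : IsLocallyQuasiCocommutative A φ R
  /-- `(φ_{a,b} ⊗ id_c)(R^{(ab,c)}) = R^{(a,c)}_{13} R^{(b,c)}_{23}` -/
  map_left : ∀ a b c : S,
    MinTensor.map (φ a b) (StarAlgHom.id ℂ (A c)) (R (a * b) c) =
      MinTensor.leg₁₃ (R a c) * MinTensor.leg₂₃ (R b c)
  /-- `(id_a ⊗ φ_{b,c})(R^{(a,bc)}) = R^{(a,c)}_{13} R^{(a,b)}_{12}` -/
  map_right : ∀ a b c : S,
    MinTensor.map (StarAlgHom.id ℂ (A a)) (φ b c) (R a (b * c)) =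
      MinTensor.assoc (A a) (A b) (A c) (MinTensor.leg₁₃ (R a c) * MinTensor.leg₁₂ (R a b))

/-- Local triangularity of a locally quasi-cocommutative C⋆-WCS. -/
structure IsLocallyTriangular {S : Type*} [CommMonoid S] (A : S → Type u)
    [∀ a, CStarAlgebra (A a)] (φ : ∀ a b, A (a * b) →⋆ₐ[ℂ] MinTensor (A a) (A b))
    (R : ∀ a b, MinTensor (A a) (A b)) : Prop where
  quasiTriangular : IsLocallyQuasiTriangular A φ R
  /-- `R^{(a,b)} τ_{b,a}(R^{(b,a)}) = I_a ⊗ I_b` -/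
  mul_flip : ∀ a b : S, R a b * MinTensor.comm (A b) (A a) (R b a) = MinTensor.tmul 1 1

end WCS

end

/-! Write T for the map sorting the tensor factors, with n = k + 1 throughout. Two facts drive the
proof. First, T is natural in both algebras and commutes, in the evident sense, with the flip, with
rebracketing and with the leg embeddings. Second, R ↦ T(R^{⊗n}) preserves products, adjoints and the
unit. Every equation in the definitions is built from these operations, so the equation for the n-th
powers results from taking the n-th tensor power of the given one and moving T past everything else.

The compatibilities of T are equalities of unital `⋆`-homomorphisms, so they need checking only on
elementary tensors. `IsSeparating` records what is needed for this, and it passes to tensor products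
and to tensor powers. The main consequences are `opHom_compPow` (part (i)), `compPow_coassoc`,
`compPow_conj` (unitary conjugation), `map_left_compPow` and `map_right_compPow` (the two
quasi-triangularity identities), and `comm_compPowElem` (the triangularity condition).

The counit is different, since maps have to be produced: the character ε^{⊗n} and its two slice maps
must be continuous for the minimal norm. They are built by induction on the number of factors, from
the tensor product of two characters and from the fact that (l ⊗ m) composed with the middle
interchange is a slice map whenever l and m are. The induction needs unital maps. In a nonzero
algebra a counit is automatically unital, and in the zero algebra there is nothing to prove. -/

/-! ### Families that determine homomorphisms, and elementary tensors -/

section Separating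

variable {A B : Type u} [CStarAlgebra A] [CStarAlgebra B]

/-- A family in `A` that contains `1` and on which unital `⋆`-homomorphisms out of `A` are
determined. -/
structure IsSeparating {ι : Type*} (i : ι → A) : Prop where
  exists_eq_one : ∃ x, i x = 1
  hom_ext : ∀ {D : Type u} [CStarAlgebra D] {f g : A →⋆ₐ[ℂ] D},
    (∀ x, f (i x) = g (i x)) → f = g

/-- The seed from which families of elementary tensors arise through `IsSeparating.tmul` and
`IsSeparating.tprod`. -/
theorem isSeparating_id : IsSeparating (fun a : A => a) :=
  ⟨⟨1, rfl⟩, fun h => StarAlgHom.ext h⟩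

/-- Holds because a ⊗ b = (a ⊗ 1)(1 ⊗ b). This reduces uniqueness on a tensor product to uniqueness
on each factor, with no further density argument. -/
theorem MinTensor.hom_ext_include {D : Type*} [CStarAlgebra D] {f g : MinTensor A B →⋆ₐ[ℂ] D}
    (hl : f.comp MinTensor.includeLeft = g.comp MinTensor.includeLeft)
    (hr : f.comp MinTensor.includeRight = g.comp MinTensor.includeRight) : f = g := by
  refine MinTensor.hom_ext fun a b => ?_
  have h : MinTensor.tmul a b = MinTensor.includeLeft a * MinTensor.includeRight b := by
    rw [includeLeft_apply, includeRight_apply, tmul_mul_tmul, one_mul, mul_one]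
  rw [h, map_mul, map_mul]
  exact congrArg₂ (· * ·) (DFunLike.congr_fun hl a) (DFunLike.congr_fun hr b)

/-- Since 1 lies in both families, agreement on all i(x) ⊗ j(y) includes agreement on i(x) ⊗ 1 and
on 1 ⊗ j(y). The restrictions to the two factors therefore coincide. -/
theorem IsSeparating.tmul {ι κ : Type*} {i : ι → A} {j : κ → B} (hi : IsSeparating i)
    (hj : IsSeparating j) :
    IsSeparating (fun p : ι × κ => MinTensor.tmul (i p.1) (j p.2)) := by
  obtain ⟨x₀, hx₀⟩ := hi.exists_eq_one
  obtain ⟨y₀, hy₀⟩ := hj.exists_eq_one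
  refine ⟨⟨(x₀, y₀), by rw [hx₀, hy₀, MinTensor.tmul_one_one]⟩, fun {D} _ f g h => ?_⟩
  refine MinTensor.hom_ext_include (hi.hom_ext fun x => ?_) (hj.hom_ext fun y => ?_)
  · have := h (x, y₀)
    rwa [hy₀] at this
  · have := h (x₀, y)
    rwa [hx₀] at this

theorem TPow.tprod_one (k : ℕ) : TPow.tprod k (fun _ => (1 : A)) = 1 := by
  induction k with
  | zero => rfl
  | succ k ih =>
    exact (congrArg (fun p : TPow A k => MinTensor.tmul p (1 : A)) ih).trans
      MinTensor.tmul_one_one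

theorem TPow.tprod_mul (k : ℕ) (x y : Fin (k + 1) → A) :
    TPow.tprod k x * TPow.tprod k y = TPow.tprod k fun i => x i * y i := by
  induction k with
  | zero => rfl
  | succ k ih =>
    exact (MinTensor.tmul_mul_tmul (A := TPow A k) _ _ _ _).trans
      (congrArg (fun p : TPow A k => MinTensor.tmul p _) (ih _ _))

theorem TPow.star_tprod (k : ℕ) (x : Fin (k + 1) → A) :
    star (TPow.tprod k x) = TPow.tprod k fun i => star (x i) := by
  induction k with
  | zero => rfl
  | succ k ih =>
    exact (MinTensor.star_tmul (A := TPow A k) _ _).trans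
      (congrArg (fun p : TPow A k => MinTensor.tmul p _) (ih _))

/-- Iterates `IsSeparating.tmul` along A^{⊗(k+2)} = A^{⊗(k+1)} ⊗ A. -/
theorem IsSeparating.tprod {ι : Type*} {i : ι → A} (hi : IsSeparating i) (k : ℕ) :
    IsSeparating (fun x : Fin (k + 1) → ι => TPow.tprod k fun t => i (x t)) := by
  obtain ⟨x₀, hx₀⟩ := hi.exists_eq_one
  induction k with
  | zero => exact ⟨⟨fun _ => x₀, hx₀⟩, fun {D} _ f g h => hi.hom_ext fun x => h fun _ => x⟩
  | succ k ih =>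
    obtain ⟨h1, h2⟩ := IsSeparating.tmul ih hi
    -- Pairs (tuple, last entry) are matched with longer tuples by appending the last entry, which
    -- turns the family of the binary product into the family of tensor powers.
    have key : ∀ p : (Fin (k + 1) → ι) × ι,
        (TPow.tprod (k + 1) fun t => i ((Fin.snoc p.1 p.2 : Fin (k + 2) → ι) t)) =
          (MinTensor.tmul (TPow.tprod k fun t => i (p.1 t)) (i p.2) : MinTensor (TPow A k) A) := by
      intro p
      simp only [TPow.tprod, Fin.snoc_castSucc, Fin.snoc_last]
      rfl
    refine ⟨⟨fun _ => x₀, ?_⟩, fun {D} _ f g h => ?_⟩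
    · simp only [hx₀]
      exact TPow.tprod_one (k + 1)
    · refine h2 (f := f) (g := g) fun p => ?_
      rw [← key p]
      exact h _

end Separating

/-! ### Compatibility of the sorting map with maps, flips, brackets and legs -/

section ShuffleIdentities

variable {A B C A' B' D : Type u} [CStarAlgebra A] [CStarAlgebra B] [CStarAlgebra C]
  [CStarAlgebra A'] [CStarAlgebra B'] [CStarAlgebra D]

theorem TPow.map_id (k : ℕ) : TPow.map (StarAlgHom.id ℂ A) k = StarAlgHom.id ℂ (TPow A k) :=
  (isSeparating_id.tprod k).hom_ext fun _ => TPow.map_tprod _ k _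

theorem TPow.map_comp (f : B →⋆ₐ[ℂ] C) (g : A →⋆ₐ[ℂ] B) (k : ℕ) :
    TPow.map (f.comp g) k = (TPow.map f k).comp (TPow.map g k) :=
  (isSeparating_id.tprod k).hom_ext fun x => by
    simp only [StarAlgHom.comp_apply, TPow.map_tprod]

theorem compPow_comp (k : ℕ) (f : D →⋆ₐ[ℂ] MinTensor A B) (g : C →⋆ₐ[ℂ] D) :
    compPow k (f.comp g) = (compPow k f).comp (TPow.map g k) := by
  rw [compPow, TPow.map_comp]; rfl

/-- Naturality of T in both algebras; on elementary tensors both sides apply f to the first entries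
and g to the second. -/
theorem map_comp_shuffle (f : A →⋆ₐ[ℂ] A') (g : B →⋆ₐ[ℂ] B') (k : ℕ) :
    (MinTensor.map (TPow.map f k) (TPow.map g k)).comp (TPow.shuffle A B k) =
      (TPow.shuffle A' B' k).comp (TPow.map (MinTensor.map f g) k) :=
  ((isSeparating_id.tmul isSeparating_id).tprod k).hom_ext fun x => by
    simp only [StarAlgHom.comp_apply, TPow.map_tprod, TPow.shuffle_tprod, MinTensor.map_tmul]

/-- Sorting and then exchanging the two blocks is the same as exchanging inside each pair and then
sorting. Part (i) and the triangularity condition both rest on this. -/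
theorem comm_comp_shuffle (k : ℕ) :
    (MinTensor.comm (TPow A k) (TPow B k)).comp (TPow.shuffle A B k) =
      (TPow.shuffle B A k).comp (TPow.map (MinTensor.comm A B) k) :=
  ((isSeparating_id.tmul isSeparating_id).tprod k).hom_ext fun x => by
    simp only [StarAlgHom.comp_apply, TPow.map_tprod, TPow.shuffle_tprod, MinTensor.comm_tmul]

variable (A B C) in
/-- The map `((A ⊗ B) ⊗ C)^{⊗n} → (A^{⊗n} ⊗ B^{⊗n}) ⊗ C^{⊗n}` sorting the tensor factors,
`n = k + 1`. -/
noncomputable def TPow.shuffle₃ (k : ℕ) :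
    TPow (MinTensor (MinTensor A B) C) k →⋆ₐ[ℂ]
      MinTensor (MinTensor (TPow A k) (TPow B k)) (TPow C k) :=
  (MinTensor.map (TPow.shuffle A B k) (StarAlgHom.id ℂ _)).comp
    (TPow.shuffle (MinTensor A B) C k)

theorem TPow.shuffle₃_tprod (k : ℕ) (x : Fin (k + 1) → A) (y : Fin (k + 1) → B)
    (z : Fin (k + 1) → C) :
    TPow.shuffle₃ A B C k (TPow.tprod k fun i => MinTensor.tmul (MinTensor.tmul (x i) (y i)) (z i)) =
      MinTensor.tmul (MinTensor.tmul (TPow.tprod k x) (TPow.tprod k y)) (TPow.tprod k z) := by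
  rw [shuffle₃, StarAlgHom.comp_apply, TPow.shuffle_tprod (A := MinTensor A B), MinTensor.map_tmul,
    TPow.shuffle_tprod]
  rfl

/-- The two ways of sorting triples, one for each bracketing, differ only by rebracketing.
Identities valued in A ⊗ (B ⊗ C) can thus be transported to `TPow.shuffle₃`. -/
theorem shuffle_comp_map_assoc (k : ℕ) :
    ((MinTensor.map (StarAlgHom.id ℂ (TPow A k)) (TPow.shuffle B C k)).comp
      (TPow.shuffle A (MinTensor B C) k)).comp (TPow.map (MinTensor.assoc A B C) k) =
    (MinTensor.assoc (TPow A k) (TPow B k) (TPow C k)).comp (TPow.shuffle₃ A B C k) :=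
  (((isSeparating_id.tmul isSeparating_id).tmul isSeparating_id).tprod k).hom_ext fun x => by
    simp only [StarAlgHom.comp_apply, TPow.map_tprod, TPow.shuffle₃_tprod, MinTensor.assoc_tmul]
    rw [TPow.shuffle_tprod, MinTensor.map_tmul, TPow.shuffle_tprod]
    rfl

/-- The leg left empty carries 1 in every factor, and sorting gathers these into 1 ⊗ ⋯ ⊗ 1 = 1. The
other two leg embeddings work the same way. -/
theorem shuffle₃_comp_leg₁₂ (k : ℕ) :
    (TPow.shuffle₃ A B C k).comp (TPow.map MinTensor.leg₁₂ k) =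
      MinTensor.leg₁₂.comp (TPow.shuffle A B k) :=
  ((isSeparating_id.tmul isSeparating_id).tprod k).hom_ext fun x => by
    simp only [StarAlgHom.comp_apply, TPow.map_tprod, TPow.shuffle_tprod, MinTensor.leg₁₂,
      MinTensor.includeLeft_apply, TPow.shuffle₃_tprod, TPow.tprod_one]

theorem shuffle₃_comp_leg₁₃ (k : ℕ) :
    (TPow.shuffle₃ A B C k).comp (TPow.map MinTensor.leg₁₃ k) =
      MinTensor.leg₁₃.comp (TPow.shuffle A C k) :=
  ((isSeparating_id.tmul isSeparating_id).tprod k).hom_ext fun x => by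
    simp only [StarAlgHom.comp_apply, TPow.map_tprod, TPow.shuffle_tprod, MinTensor.leg₁₃,
      MinTensor.map_tmul, MinTensor.includeLeft_apply, TPow.shuffle₃_tprod, TPow.tprod_one]
    exact congrArg (MinTensor.tmul _) rfl

theorem shuffle₃_comp_leg₂₃ (k : ℕ) :
    (TPow.shuffle₃ A B C k).comp (TPow.map MinTensor.leg₂₃ k) =
      MinTensor.leg₂₃.comp (TPow.shuffle B C k) :=
  ((isSeparating_id.tmul isSeparating_id).tprod k).hom_ext fun x => by
    simp only [StarAlgHom.comp_apply, TPow.map_tprod, TPow.shuffle_tprod, MinTensor.leg₂₃,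
      MinTensor.map_tmul, MinTensor.includeRight_apply, TPow.shuffle₃_tprod, TPow.tprod_one]
    exact congrArg (MinTensor.tmul _) rfl

/-- The preceding compatibility evaluated at R^{⊗n}; this is the form used in the
quasi-triangularity identities. -/
theorem shuffle₃_tprod_leg₁₂ (k : ℕ) (R : MinTensor A B) :
    TPow.shuffle₃ A B C k (TPow.tprod k fun _ => MinTensor.leg₁₂ R) =
      MinTensor.leg₁₂ (compPowElem k R) := by
  rw [← TPow.map_tprod MinTensor.leg₁₂, ← StarAlgHom.comp_apply, shuffle₃_comp_leg₁₂]
  rfl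

theorem shuffle₃_tprod_leg₁₃ (k : ℕ) (R : MinTensor A C) :
    TPow.shuffle₃ A B C k (TPow.tprod k fun _ => MinTensor.leg₁₃ R) =
      MinTensor.leg₁₃ (compPowElem k R) := by
  rw [← TPow.map_tprod MinTensor.leg₁₃, ← StarAlgHom.comp_apply, shuffle₃_comp_leg₁₃]
  rfl

theorem shuffle₃_tprod_leg₂₃ (k : ℕ) (R : MinTensor B C) :
    TPow.shuffle₃ A B C k (TPow.tprod k fun _ => MinTensor.leg₂₃ R) =
      MinTensor.leg₂₃ (compPowElem k R) := by
  rw [← TPow.map_tprod MinTensor.leg₂₃, ← StarAlgHom.comp_apply, shuffle₃_comp_leg₂₃]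
  rfl

end ShuffleIdentities

/-! ### Componentwise powers of structure maps and of R -/

section ComponentwisePowers

variable {A B C D E F : Type u} [CStarAlgebra A] [CStarAlgebra B] [CStarAlgebra C]
  [CStarAlgebra D] [CStarAlgebra E] [CStarAlgebra F]

/-- Part (i): the flip is moved through T and then absorbed into f^{⊗n} by functoriality. -/
theorem opHom_compPow (k : ℕ) (f : C →⋆ₐ[ℂ] MinTensor A B) :
    opHom (compPow k f) = compPow k (opHom f) := by
  rw [opHom, compPow, ← StarAlgHom.comp_assoc, comm_comp_shuffle, StarAlgHom.comp_assoc,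
    ← TPow.map_comp]
  rfl

theorem map_id_comp (h : E →⋆ₐ[ℂ] F) (g : D →⋆ₐ[ℂ] E) :
    MinTensor.map (StarAlgHom.id ℂ A) (h.comp g) =
      (MinTensor.map (StarAlgHom.id ℂ A) h).comp (MinTensor.map (StarAlgHom.id ℂ A) g) :=
  MinTensor.hom_ext fun a b => by simp only [StarAlgHom.comp_apply, MinTensor.map_tmul]; rfl

theorem map_comp_id (h : E →⋆ₐ[ℂ] F) (g : D →⋆ₐ[ℂ] E) :
    MinTensor.map (h.comp g) (StarAlgHom.id ℂ A) =
      (MinTensor.map h (StarAlgHom.id ℂ A)).comp (MinTensor.map g (StarAlgHom.id ℂ A)) :=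
  MinTensor.hom_ext fun a b => by simp only [StarAlgHom.comp_apply, MinTensor.map_tmul]; rfl

/-- Since g^{(n)} = T ∘ g^{⊗n}, naturality moves g^{⊗n} ⊗ id to the inner side of T, where it
becomes (g ⊗ id)^{⊗n}. The two remaining sortings compose to `TPow.shuffle₃`. -/
theorem map_compPow_id_comp_shuffle (k : ℕ) (g : D →⋆ₐ[ℂ] MinTensor A B) :
    (MinTensor.map (compPow k g) (StarAlgHom.id ℂ (TPow C k))).comp (TPow.shuffle D C k) =
      (TPow.shuffle₃ A B C k).comp (TPow.map (MinTensor.map g (StarAlgHom.id ℂ C)) k) := by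
  -- Naturality applies to a tensor product of two powers, so the identity of C^{⊗n} is temporarily
  -- written as the power of the identity of C.
  rw [compPow, map_comp_id, StarAlgHom.comp_assoc, ← TPow.map_id, map_comp_shuffle, TPow.map_id,
    ← StarAlgHom.comp_assoc]
  rfl

/-- The mirror case. The outer map sorts with the bracketing A ⊗ (B ⊗ C), as
`shuffle_comp_map_assoc` expects. -/
theorem map_id_compPow_comp_shuffle (k : ℕ) (g : D →⋆ₐ[ℂ] MinTensor B C) :
    (MinTensor.map (StarAlgHom.id ℂ (TPow A k)) (compPow k g)).comp (TPow.shuffle A D k) =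
      ((MinTensor.map (StarAlgHom.id ℂ (TPow A k)) (TPow.shuffle B C k)).comp
        (TPow.shuffle A (MinTensor B C) k)).comp
          (TPow.map (MinTensor.map (StarAlgHom.id ℂ A) g) k) := by
  rw [compPow, map_id_comp, StarAlgHom.comp_assoc, ← TPow.map_id, map_comp_shuffle, TPow.map_id,
    ← StarAlgHom.comp_assoc]

/-- Once T is moved outside, both sides are one fixed sorting map applied to the n-th tensor power
of the hypothesis. Independent algebras for f, g, f', g' let the identifications of A_{(ab)c} with
A_{a(bc)}, and the case of the bialgebra at e, be handled together. -/
theorem compPow_coassoc (k : ℕ) {f : F →⋆ₐ[ℂ] MinTensor A D} {g : D →⋆ₐ[ℂ] MinTensor B C}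
    {f' : F →⋆ₐ[ℂ] MinTensor E C} {g' : E →⋆ₐ[ℂ] MinTensor A B}
    (h : ∀ x, MinTensor.map (StarAlgHom.id ℂ A) g (f x) =
      MinTensor.assoc A B C (MinTensor.map g' (StarAlgHom.id ℂ C) (f' x))) (x : TPow F k) :
    MinTensor.map (StarAlgHom.id ℂ _) (compPow k g) (compPow k f x) =
      MinTensor.assoc _ _ _ (MinTensor.map (compPow k g') (StarAlgHom.id ℂ _)
        (compPow k f' x)) := by
  have h' : (MinTensor.map (StarAlgHom.id ℂ A) g).comp f =
    (MinTensor.assoc A B C).comp ((MinTensor.map g' (StarAlgHom.id ℂ C)).comp f') :=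
      StarAlgHom.ext h
  refine DFunLike.congr_fun (f := (MinTensor.map (StarAlgHom.id ℂ _) (compPow k g)).comp
    (compPow k f)) (g := (MinTensor.assoc _ _ _).comp
      ((MinTensor.map (compPow k g') (StarAlgHom.id ℂ _)).comp (compPow k f'))) ?_ x
  -- Only the inner maps f and f' are unfolded; g and g' must stay folded for the two exchange
  -- lemmas to match.
  rw [compPow.eq_1 k f, compPow.eq_1 k f', ← StarAlgHom.comp_assoc, map_id_compPow_comp_shuffle,
    ← StarAlgHom.comp_assoc _ (TPow.shuffle E C k), map_compPow_id_comp_shuffle,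
    StarAlgHom.comp_assoc, ← TPow.map_comp, h', TPow.map_comp, ← StarAlgHom.comp_assoc,
    shuffle_comp_map_assoc, TPow.map_comp]
  rfl

/-- Serves the axiom φ_{a,e}(x) = x ⊗ I_e, which says that φ_{a,e} is this inclusion; its mirror
image serves φ_{e,a}. -/
theorem compPow_includeLeft (k : ℕ) :
    compPow k (MinTensor.includeLeft : A →⋆ₐ[ℂ] MinTensor A B) = MinTensor.includeLeft :=
  (isSeparating_id.tprod k).hom_ext fun x => by
    simp only [compPow, StarAlgHom.comp_apply, TPow.map_tprod, MinTensor.includeLeft_apply,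
      TPow.shuffle_tprod, TPow.tprod_one]

theorem compPow_includeRight (k : ℕ) :
    compPow k (MinTensor.includeRight : B →⋆ₐ[ℂ] MinTensor A B) = MinTensor.includeRight :=
  (isSeparating_id.tprod k).hom_ext fun x => by
    simp only [compPow, StarAlgHom.comp_apply, TPow.map_tprod, MinTensor.includeRight_apply,
      TPow.shuffle_tprod, TPow.tprod_one]

theorem compPowElem_mul (k : ℕ) (x y : MinTensor A B) :
    compPowElem k x * compPowElem k y = compPowElem k (x * y) := by
  rw [compPowElem, compPowElem, ← map_mul, TPow.tprod_mul]
  rfl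

theorem compPowElem_one (k : ℕ) : compPowElem k (1 : MinTensor A B) = 1 := by
  rw [compPowElem, TPow.tprod_one, map_one]

theorem star_compPowElem (k : ℕ) (x : MinTensor A B) :
    star (compPowElem k x) = compPowElem k (star x) := by
  rw [compPowElem, ← map_star, TPow.star_tprod]
  rfl

theorem compPowElem_mem_unitary (k : ℕ) {R : MinTensor A B} (hR : R ∈ unitary (MinTensor A B)) :
    compPowElem k R ∈ unitary (MinTensor (TPow A k) (TPow B k)) := by
  rw [Unitary.mem_iff] at hR ⊢
  rw [star_compPowElem, compPowElem_mul, compPowElem_mul, hR.1, hR.2, compPowElem_one]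
  exact ⟨rfl, rfl⟩

theorem comm_compPowElem (k : ℕ) (R : MinTensor A B) :
    MinTensor.comm (TPow A k) (TPow B k) (compPowElem k R) =
      compPowElem k (MinTensor.comm A B R) := by
  refine (DFunLike.congr_fun (comm_comp_shuffle k) _).trans ?_
  rw [StarAlgHom.comp_apply, TPow.map_tprod]
  rfl

/-- On x₁ ⊗ ⋯ ⊗ xₙ the conjugation acts factor by factor, because T and products of elementary
tensors are multiplicative. -/
theorem compPow_conj (k : ℕ) {R : MinTensor A B} (hR : R ∈ unitary (MinTensor A B))
    {f g : C →⋆ₐ[ℂ] MinTensor A B} (h : ∀ x, R * f x * star R = g x) (x : TPow C k) :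
    compPowElem k R * compPow k f x * star (compPowElem k R) = compPow k g x := by
  -- Unitarity makes conjugation a `⋆`-automorphism, so the left side is a unital `⋆`-homomorphism
  -- in x and may be compared on elementary tensors.
  let c : MinTensor (TPow A k) (TPow B k) →⋆ₐ[ℂ] MinTensor (TPow A k) (TPow B k) :=
    (Unitary.conjStarAlgAut ℂ _ ⟨_, compPowElem_mem_unitary k hR⟩ : _ ≃⋆ₐ[ℂ] _)
  refine DFunLike.congr_fun (f := c.comp (compPow k f)) ?_ x
  refine (isSeparating_id.tprod k).hom_ext fun x => ?_
  change compPowElem k R * TPow.shuffle A B k (TPow.map f k _) * star (compPowElem k R) =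
    TPow.shuffle A B k (TPow.map g k _)
  rw [star_compPowElem, TPow.map_tprod, TPow.map_tprod, compPowElem, compPowElem, ← map_mul,
    ← map_mul, TPow.tprod_mul, TPow.tprod_mul]
  simp only [h]

/-- Evaluate the exchange law for T at R^{⊗n}: the hypothesis turns each factor into a product of
two legs, and (XY)^{⊗n} = X^{⊗n} Y^{⊗n} separates them. -/
theorem map_left_compPow (k : ℕ) {g : D →⋆ₐ[ℂ] MinTensor A B} {R : MinTensor D C}
    {R₁ : MinTensor A C} {R₂ : MinTensor B C}
    (h : MinTensor.map g (StarAlgHom.id ℂ C) R = MinTensor.leg₁₃ R₁ * MinTensor.leg₂₃ R₂) :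
    MinTensor.map (compPow k g) (StarAlgHom.id ℂ (TPow C k)) (compPowElem k R) =
      MinTensor.leg₁₃ (compPowElem k R₁) * MinTensor.leg₂₃ (compPowElem k R₂) := by
  refine (DFunLike.congr_fun (map_compPow_id_comp_shuffle k g) _).trans ?_
  rw [StarAlgHom.comp_apply, TPow.map_tprod, h, ← TPow.tprod_mul, map_mul,
    shuffle₃_tprod_leg₁₃, shuffle₃_tprod_leg₂₃]

theorem map_right_compPow (k : ℕ) {g : D →⋆ₐ[ℂ] MinTensor B C} {R : MinTensor A D}
    {R₁ : MinTensor A C} {R₂ : MinTensor A B}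
    (h : MinTensor.map (StarAlgHom.id ℂ A) g R =
      MinTensor.assoc A B C (MinTensor.leg₁₃ R₁ * MinTensor.leg₁₂ R₂)) :
    MinTensor.map (StarAlgHom.id ℂ (TPow A k)) (compPow k g) (compPowElem k R) =
      MinTensor.assoc _ _ _
        (MinTensor.leg₁₃ (compPowElem k R₁) * MinTensor.leg₁₂ (compPowElem k R₂)) := by
  refine (DFunLike.congr_fun (map_id_compPow_comp_shuffle k g) _).trans ?_
  -- The rebracketing in the hypothesis is collected into its n-th power, so that it can be moved
  -- outside the sorting.
  rw [StarAlgHom.comp_apply, TPow.map_tprod, h, ← TPow.map_tprod (MinTensor.assoc A B C)]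
  refine (DFunLike.congr_fun (shuffle_comp_map_assoc k) _).trans ?_
  rw [StarAlgHom.comp_apply, ← TPow.tprod_mul, map_mul,
    shuffle₃_tprod_leg₁₃, shuffle₃_tprod_leg₁₂]

/-- For equal indices both sides are identities. Identifications such as A_{ab} = A_{ba} can
therefore be absorbed into the structure maps before powers are taken. -/
theorem castHom_TPow {S : Type*} (A : S → Type u) [∀ a, CStarAlgebra (A a)] (k : ℕ) {a b : S}
    (h : a = b) : castHom (fun a => TPow (A a) k) h = TPow.map (castHom A h) k := by
  subst h
  exact (TPow.map_id k).symm

end ComponentwisePowers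

/-! ### Characters, slice maps and the counit of a power -/

section Counit

variable {A B C : Type u} [CStarAlgebra A] [CStarAlgebra B] [CStarAlgebra C]

theorem MinTensor.induction_tmul {p : MinTensor A B → Prop} (x : MinTensor A B)
    (hp : IsClosed {x | p x}) (tmul : ∀ a b, p (MinTensor.tmul a b))
    (add : ∀ x y, p x → p y → p (x + y)) : p x :=
  MinTensor.induction_on x hp fun y => AlgTensor.induction_on y tmul fun x y hx hy => by
    rw [map_add]; exact add _ _ hx hy

theorem MinTensor.continuous_tmul_left (b : B) :
    Continuous fun a : A => MinTensor.tmul a b := by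
  have h : (fun a : A => MinTensor.tmul a b) = fun a : A =>
      (MinTensor.includeLeft a : MinTensor A B) * MinTensor.includeRight b := by
    ext a
    rw [includeLeft_apply, includeRight_apply, tmul_mul_tmul, one_mul, mul_one]
  rw [h]
  exact (map_continuous MinTensor.includeLeft).mul continuous_const

theorem MinTensor.continuous_tmul_right (a : A) :
    Continuous fun b : B => MinTensor.tmul a b := by
  have h : (fun b : B => MinTensor.tmul a b) = fun b : B =>
      (MinTensor.includeLeft a : MinTensor A B) * MinTensor.includeRight b := by
    ext b
    rw [includeLeft_apply, includeRight_apply, tmul_mul_tmul, one_mul, mul_one]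
  rw [h]
  exact continuous_const.mul (map_continuous MinTensor.includeRight)

/-- The tensor product of two characters, `a ⊗ b ↦ ε(a) δ(b)`. -/
theorem MinTensor.exists_character [Nontrivial (MinTensor A B)] (ε : A →⋆ₐ[ℂ] ℂ)
    (δ : B →⋆ₐ[ℂ] ℂ) :
    ∃ χ : MinTensor A B →⋆ₐ[ℂ] ℂ, ∀ a b, χ (MinTensor.tmul a b) = ε a * δ b := by
  let f : AlgTensor A B →⋆ₐ[ℂ] ℂ := AlgTensor.lift ε δ fun a b => Commute.all _ _
  have hA : Nontrivial A := (MinTensor.includeLeft : A →⋆ₐ[ℂ] MinTensor A B).toRingHom.domain_nontrivial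
  have hB : Nontrivial B := (MinTensor.includeRight : B →⋆ₐ[ℂ] MinTensor A B).toRingHom.domain_nontrivial
  -- Boundedness of ε ⊗ δ: composing with the scalar embeddings gives a tensor product of
  -- homomorphisms, hence a contraction. It equals f(x) times 1 on the algebraic tensor product, and
  -- ‖1‖ = 1 in a nonzero algebra, so |f(x)| ≤ ‖x‖.
  let F : MinTensor A B →⋆ₐ[ℂ] MinTensor A B :=
    MinTensor.map ((StarAlgHom.ofId ℂ A).comp ε) ((StarAlgHom.ofId ℂ B).comp δ)
  have hF : ∀ x, F (MinTensor.ofAlg x) = f x • 1 := by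
    intro x
    induction x using AlgTensor.induction_on with
    | tmul a b =>
      refine (MinTensor.map_tmul _ _ a b).trans ?_
      change MinTensor.tmul (algebraMap ℂ A (ε a)) (algebraMap ℂ B (δ b)) = (ε a * δ b) • 1
      rw [Algebra.algebraMap_eq_smul_one, Algebra.algebraMap_eq_smul_one, smul_tmul, tmul_smul,
        tmul_one_one, smul_smul]
    | add x y hx hy => rw [map_add, map_add, map_add, add_smul, hx, hy]
  have hf : ∀ x, ‖f x‖ ≤ ‖x‖ := by
    intro x
    have h := NonUnitalStarAlgHom.norm_apply_le F (MinTensor.ofAlg x)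
    rwa [hF, norm_smul, norm_one, mul_one, MinTensor.norm_ofAlg] at h
  exact ⟨MinTensor.extend f hf, fun a b => MinTensor.extend_ofAlg f hf _⟩

theorem MinTensor.interchange_interchange (A B C D : Type u) [CStarAlgebra A] [CStarAlgebra B]
    [CStarAlgebra C] [CStarAlgebra D] (x : MinTensor (MinTensor A B) (MinTensor C D)) :
    MinTensor.interchange A C B D (MinTensor.interchange A B C D x) = x := by
  refine DFunLike.congr_fun (f := (MinTensor.interchange A C B D).comp
    (MinTensor.interchange A B C D)) (g := StarAlgHom.id ℂ _) ?_ x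
  refine ((isSeparating_id.tmul isSeparating_id).tmul
    (isSeparating_id.tmul isSeparating_id)).hom_ext fun x => ?_
  rw [StarAlgHom.comp_apply, interchange_tmul, interchange_tmul]
  rfl

/-- `l` is the slice map `ε ⊗ id`. -/
def IsLeftSlice (ε : A →⋆ₐ[ℂ] ℂ) (l : MinTensor A A →⋆ₐ[ℂ] A) : Prop :=
  ∀ a b, l (MinTensor.tmul a b) = ε a • b

/-- `r` is the slice map `id ⊗ ε`. -/
def IsRightSlice (ε : A →⋆ₐ[ℂ] ℂ) (r : MinTensor A A →⋆ₐ[ℂ] A) : Prop :=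
  ∀ a b, r (MinTensor.tmul a b) = ε b • a

/-- Separate closedness suffices, as the two variables are approximated one after the other. -/
theorem MinTensor.induction_tmul_tmul {q : MinTensor A B → MinTensor A B → Prop}
    (x y : MinTensor A B) (h₁ : ∀ y, IsClosed {x | q x y}) (h₂ : ∀ x, IsClosed {y | q x y})
    (tmul : ∀ a b c d, q (MinTensor.tmul a b) (MinTensor.tmul c d))
    (add_left : ∀ x x' y, q x y → q x' y → q (x + x') y)
    (add_right : ∀ x y y', q x y → q x y' → q x (y + y')) : q x y :=
  MinTensor.induction_tmul x (h₁ y)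
    (fun a b => MinTensor.induction_tmul y (h₂ _) (tmul a b) fun _ _ => add_right _ _ _)
    fun _ _ => add_left _ _ _

/-- A slice map must satisfy T(x ⊗ y) = χ(x) y for all x and y of A ⊗ B, not only for elementary
ones. Both sides are additive and continuous in each variable, which closes the gap. -/
theorem IsLeftSlice.of_tmul {χ : MinTensor A B →⋆ₐ[ℂ] ℂ}
    {T : MinTensor (MinTensor A B) (MinTensor A B) →⋆ₐ[ℂ] MinTensor A B}
    (h : ∀ a b c d, T (MinTensor.tmul (MinTensor.tmul a b) (MinTensor.tmul c d)) =
      χ (MinTensor.tmul a b) • MinTensor.tmul c d) : IsLeftSlice χ T := by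
  intro x y
  have hT : Continuous T := map_continuous T
  have hχ : Continuous χ := map_continuous χ
  refine MinTensor.induction_tmul_tmul
    (q := fun x y => T (MinTensor.tmul x y) = χ x • y) x y
    (fun y => ?_) (fun x => ?_) h (fun x x' y hx hx' => ?_) (fun x y y' hy hy' => ?_)
  · have := hT.comp (MinTensor.continuous_tmul_left y)
    exact isClosed_eq this (hχ.smul continuous_const)
  · have := hT.comp (MinTensor.continuous_tmul_right x)
    exact isClosed_eq this (continuous_const_smul _)
  · rw [MinTensor.add_tmul, map_add, map_add, add_smul, hx, hx']
  · rw [MinTensor.tmul_add, map_add, smul_add, hy, hy']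

/-- The interchange brings together the two A-factors and the two B-factors, on which l and m slice
separately; the scalars ε(a) and δ(b) multiply to χ(a ⊗ b). -/
theorem IsLeftSlice.tensor {ε : A →⋆ₐ[ℂ] ℂ} {l : MinTensor A A →⋆ₐ[ℂ] A} {δ : B →⋆ₐ[ℂ] ℂ}
    {m : MinTensor B B →⋆ₐ[ℂ] B} (hl : IsLeftSlice ε l) (hm : IsLeftSlice δ m)
    {χ : MinTensor A B →⋆ₐ[ℂ] ℂ} (hχ : ∀ a b, χ (MinTensor.tmul a b) = ε a * δ b) :
    IsLeftSlice χ ((MinTensor.map l m).comp (MinTensor.interchange A B A B)) :=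
  IsLeftSlice.of_tmul fun a b c d => by
    rw [StarAlgHom.comp_apply, MinTensor.interchange_tmul, MinTensor.map_tmul, hl, hm, hχ,
      MinTensor.smul_tmul, MinTensor.tmul_smul, smul_smul]

theorem IsRightSlice.of_tmul {χ : MinTensor A B →⋆ₐ[ℂ] ℂ}
    {T : MinTensor (MinTensor A B) (MinTensor A B) →⋆ₐ[ℂ] MinTensor A B}
    (h : ∀ a b c d, T (MinTensor.tmul (MinTensor.tmul a b) (MinTensor.tmul c d)) =
      χ (MinTensor.tmul c d) • MinTensor.tmul a b) : IsRightSlice χ T := by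
  intro x y
  have hT : Continuous T := map_continuous T
  have hχ : Continuous χ := map_continuous χ
  refine MinTensor.induction_tmul_tmul
    (q := fun x y => T (MinTensor.tmul x y) = χ y • x) x y
    (fun y => ?_) (fun x => ?_) h (fun x x' y hx hx' => ?_) (fun x y y' hy hy' => ?_)
  · have := hT.comp (MinTensor.continuous_tmul_left y)
    exact isClosed_eq this (continuous_const_smul _)
  · have := hT.comp (MinTensor.continuous_tmul_right x)
    exact isClosed_eq this (hχ.smul continuous_const)
  · rw [MinTensor.add_tmul, map_add, smul_add, hx, hx']
  · rw [MinTensor.tmul_add, map_add, map_add, add_smul, hy, hy']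

theorem IsRightSlice.tensor {ε : A →⋆ₐ[ℂ] ℂ} {l : MinTensor A A →⋆ₐ[ℂ] A} {δ : B →⋆ₐ[ℂ] ℂ}
    {m : MinTensor B B →⋆ₐ[ℂ] B} (hl : IsRightSlice ε l) (hm : IsRightSlice δ m)
    {χ : MinTensor A B →⋆ₐ[ℂ] ℂ} (hχ : ∀ a b, χ (MinTensor.tmul a b) = ε a * δ b) :
    IsRightSlice χ ((MinTensor.map l m).comp (MinTensor.interchange A B A B)) :=
  IsRightSlice.of_tmul fun a b c d => by
    rw [StarAlgHom.comp_apply, MinTensor.interchange_tmul, MinTensor.map_tmul, hl, hm, hχ,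
      MinTensor.smul_tmul, MinTensor.tmul_smul, smul_smul]

/-- The two interchanges cancel, leaving (l ∘ Δ) ⊗ (m ∘ Γ) = id. This is the counit property of the
tensor product of two comultiplications. -/
theorem MinTensor.comp_tensor_section {l : MinTensor A A →⋆ₐ[ℂ] A} {m : MinTensor B B →⋆ₐ[ℂ] B}
    {Δ : A →⋆ₐ[ℂ] MinTensor A A} {Γ : B →⋆ₐ[ℂ] MinTensor B B} (hl : ∀ x, l (Δ x) = x)
    (hm : ∀ x, m (Γ x) = x) (x : MinTensor A B) :
    (MinTensor.map l m).comp (MinTensor.interchange A B A B)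
      ((MinTensor.interchange A A B B).comp (MinTensor.map Δ Γ) x) = x := by
  rw [StarAlgHom.comp_apply, StarAlgHom.comp_apply, interchange_interchange]
  refine DFunLike.congr_fun (f := (MinTensor.map l m).comp (MinTensor.map Δ Γ))
    (g := StarAlgHom.id ℂ _) (MinTensor.hom_ext fun a b => ?_) x
  rw [StarAlgHom.comp_apply, map_tmul, map_tmul, hl, hm]
  rfl

/-- Exhibits Δ^{(n+1)} as the tensor product of the comultiplications Δ^{(n)} and Δ, which makes
induction on the number of factors possible. -/
theorem compPow_succ (k : ℕ) (f : C →⋆ₐ[ℂ] MinTensor A B) :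
    compPow (k + 1) f = ((MinTensor.interchange (TPow A k) (TPow B k) A B).comp
      (MinTensor.map (compPow k f) f) : MinTensor (TPow C k) C →⋆ₐ[ℂ]
        MinTensor (MinTensor (TPow A k) A) (MinTensor (TPow B k) B)) :=
  MinTensor.hom_ext (A := TPow C k) fun c d => by
    refine (congrArg (TPow.shuffle A B (k + 1))
      (MinTensor.map_tmul (TPow.map f k) f c d)).trans ?_
    refine (congrArg (MinTensor.interchange (TPow A k) (TPow B k) A B)
      (MinTensor.map_tmul (TPow.shuffle A B k) (StarAlgHom.id ℂ _) _ _)).trans ?_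
    exact congrArg (MinTensor.interchange (TPow A k) (TPow B k) A B)
      (MinTensor.map_tmul (compPow k f) f c d).symm

theorem TPow.nontrivial_base (k : ℕ) [h : Nontrivial (TPow A k)] : Nontrivial A := by
  cases k with
  | zero => exact h
  | succ k =>
    have : Nontrivial (MinTensor (TPow A k) A) := h
    exact (MinTensor.includeRight : A →⋆ₐ[ℂ] MinTensor (TPow A k) A).toRingHom.domain_nontrivial

/-- Induction with `compPow_succ`, tensoring the character and both slices with those of one more
factor. Nontriviality is carried along because the zero algebra has no unital character. -/
theorem TPow.exists_counit (k : ℕ) (hk : Nontrivial (TPow A k)) {Δ : A →⋆ₐ[ℂ] MinTensor A A}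
    {ε : A →⋆ₐ[ℂ] ℂ} {l r : MinTensor A A →⋆ₐ[ℂ] A} (hl : IsLeftSlice ε l)
    (hr : IsRightSlice ε r) (hlΔ : ∀ x, l (Δ x) = x) (hrΔ : ∀ x, r (Δ x) = x) :
    ∃ (χ : TPow A k →⋆ₐ[ℂ] ℂ) (L R : MinTensor (TPow A k) (TPow A k) →⋆ₐ[ℂ] TPow A k),
      IsLeftSlice χ L ∧ IsRightSlice χ R ∧ (∀ x, L (compPow k Δ x) = x) ∧
        ∀ x, R (compPow k Δ x) = x := by
  induction k with
  | zero => exact ⟨ε, l, r, hl, hr, hlΔ, hrΔ⟩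
  | succ k ih =>
    have hk' : Nontrivial (MinTensor (TPow A k) A) := hk
    have : Nontrivial (TPow A k) :=
      (MinTensor.includeLeft : TPow A k →⋆ₐ[ℂ] MinTensor (TPow A k) A).toRingHom.domain_nontrivial
    obtain ⟨χ, L, R, hL, hR, hLΔ, hRΔ⟩ := ih this
    obtain ⟨χ', hχ'⟩ := MinTensor.exists_character χ ε
    rw [compPow_succ]
    exact ⟨χ', _, _, hL.tensor hl hχ', hR.tensor hr hχ',
      MinTensor.comp_tensor_section hLΔ hlΔ, MinTensor.comp_tensor_section hRΔ hrΔ⟩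

/-- A multiplicative `⋆`-homomorphism preserving `1` is a unital `⋆`-homomorphism. -/
noncomputable def NonUnitalStarAlgHom.toUnital {D : Type*} [CStarAlgebra D] (f : A →⋆ₙₐ[ℂ] D)
    (h : f 1 = 1) : A →⋆ₐ[ℂ] D :=
  { f with
    map_one' := h
    commutes' := fun c => by
      change f (algebraMap ℂ A c) = algebraMap ℂ D c
      rw [Algebra.algebraMap_eq_smul_one, map_smul, h, Algebra.algebraMap_eq_smul_one] }

/-- Reduces the non-unital notion of counit to the unital construction by showing that ε and both
slices preserve 1. -/
theorem IsCounit.compPow {Δ : A →⋆ₐ[ℂ] MinTensor A A} {ε : A →⋆ₙₐ[ℂ] ℂ} (h : IsCounit Δ ε)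
    (k : ℕ) : ∃ χ : TPow A k →⋆ₙₐ[ℂ] ℂ, IsCounit (compPow k Δ) χ := by
  -- If the power is the zero algebra, the zero maps form a counit.
  obtain hk | hk := subsingleton_or_nontrivial (TPow A k)
  · exact ⟨0, ⟨0, fun _ _ => Subsingleton.elim _ _, fun _ => Subsingleton.elim _ _⟩,
      ⟨0, fun _ _ => Subsingleton.elim _ _, fun _ => Subsingleton.elim _ _⟩⟩
  have hA : Nontrivial A := TPow.nontrivial_base k
  obtain ⟨⟨l, hl, hlΔ⟩, r, hr, hrΔ⟩ := h
  -- Compute l(1) twice: it is ε(1) 1 since 1 = 1 ⊗ 1, and it is 1 since 1 = Δ(1). As A is nonzero,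
  -- ε(1) = 1.
  have hε : ε 1 = 1 := by
    have h1 : l 1 = ε 1 • (1 : A) := by rw [← MinTensor.tmul_one_one, hl]
    have h2 : l 1 = 1 := by
      have h3 := hlΔ 1
      rwa [map_one] at h3
    rw [h2] at h1
    have h4 : algebraMap ℂ A 1 = algebraMap ℂ A (ε 1) := by
      rw [map_one, Algebra.algebraMap_eq_smul_one, ← h1]
    exact ((algebraMap ℂ A).injective h4).symm
  have hl1 : l 1 = 1 := by rw [← MinTensor.tmul_one_one, hl, hε, one_smul]
  have hr1 : r 1 = 1 := by rw [← MinTensor.tmul_one_one, hr, hε, one_smul]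
  obtain ⟨χ, L, R, hL, hR, hLΔ, hRΔ⟩ := TPow.exists_counit k hk (Δ := Δ) (ε := ε.toUnital hε)
    (l := l.toUnital hl1) (r := r.toUnital hr1) hl hr hlΔ hrΔ
  exact ⟨χ, ⟨L, hL, hLΔ⟩, R, hR, hRΔ⟩

end Counit

/-! ### Passage of each axiom to the powers -/

section Main

variable {S : Type v} {A : S → Type u} [∀ a, CStarAlgebra (A a)]

theorem compPow_castHom {B C : Type u} [CStarAlgebra B] [CStarAlgebra C] (k : ℕ) {a b : S}
    (h : a = b) (f : A b →⋆ₐ[ℂ] MinTensor B C) :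
    (compPow k f).comp (castHom (fun a => TPow (A a) k) h) = compPow k (f.comp (castHom A h)) := by
  rw [castHom_TPow, compPow_comp]

theorem IsCStarWCS.compPow [Monoid S] {φ : ∀ a b, A (a * b) →⋆ₐ[ℂ] MinTensor (A a) (A b)}
    (h : IsCStarWCS A φ) (k : ℕ) :
    IsCStarWCS (fun a => TPow (A a) k) (fun a b => compPow k (φ a b)) where
  coassoc a b c x := by
    -- The identification of A_{(ab)c} with A_{a(bc)} is treated as part of the inner map and then
    -- pulled back out of the power.
    have := compPow_coassoc k (f := (φ a (b * c)).comp (castHom A (mul_assoc a b c)))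
      (h.coassoc a b c) x
    rwa [← compPow_castHom] at this
  bialgebra_one := by
    rw [compPow_castHom]
    intro x
    -- Coassociativity at e is `compPow_coassoc` with all comultiplications equal; the bialgebra
    -- axiom is oriented the other way, hence the two reversals.
    exact (compPow_coassoc k (fun x => (h.bialgebra_one x).symm) x).symm
  exists_counit := by
    obtain ⟨ε, hε⟩ := h.exists_counit
    rw [compPow_castHom]
    exact hε.compPow k
  one_left a x := by
    have h1 : (φ 1 a).comp (castHom A (one_mul a).symm) = MinTensor.includeRight :=
      StarAlgHom.ext (h.one_left a)
    rw [← StarAlgHom.comp_apply, compPow_castHom, h1, compPow_includeRight]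
    rfl
  one_right a x := by
    have h1 : (φ a 1).comp (castHom A (mul_one a).symm) = MinTensor.includeLeft :=
      StarAlgHom.ext (h.one_right a)
    rw [← StarAlgHom.comp_apply, compPow_castHom, h1, compPow_includeLeft]
    rfl

variable [CommMonoid S] {φ : ∀ a b, A (a * b) →⋆ₐ[ℂ] MinTensor (A a) (A b)}
  {R : ∀ a b, MinTensor (A a) (A b)}

theorem IsLocallyQuasiCocommutative.compPow (h : IsLocallyQuasiCocommutative A φ R) (k : ℕ) :
    IsLocallyQuasiCocommutative (fun a => TPow (A a) k) (fun a b => compPow k (φ a b))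
      (fun a b => compPowElem k (R a b)) where
  wcs := h.wcs.compPow k
  unitary_mem a b := compPowElem_mem_unitary k (h.unitary_mem a b)
  conj_eq_op a b x := by
    -- The identification A_{ab} = A_{ba} is included in the conjugated map, since `compPow_conj`
    -- wants both maps on the same domain; part (i) then moves the flip outside the power.
    rw [compPow_conj k (h.unitary_mem a b)
      (g := (opHom (φ b a)).comp (castHom A (mul_comm a b))) (h.conj_eq_op a b),
      ← compPow_castHom, opHom_compPow]
    rfl

theorem IsLocallyQuasiTriangular.compPow (h : IsLocallyQuasiTriangular A φ R) (k : ℕ) :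
    IsLocallyQuasiTriangular (fun a => TPow (A a) k) (fun a b => compPow k (φ a b))
      (fun a b => compPowElem k (R a b)) where
  quasiCocommutative := h.quasiCocommutative.compPow k
  map_left a b c := map_left_compPow k (h.map_left a b c)
  map_right a b c := map_right_compPow k (h.map_right a b c)

theorem IsLocallyTriangular.compPow (h : IsLocallyTriangular A φ R) (k : ℕ) :
    IsLocallyTriangular (fun a => TPow (A a) k) (fun a b => compPow k (φ a b))
      (fun a b => compPowElem k (R a b)) where
  quasiTriangular := h.quasiTriangular.compPow k
  mul_flip a b := by
    -- The flip and the product both pass inside R ↦ T(R^{⊗n}), leaving the image of 1 ⊗ 1.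
    rw [comm_compPowElem, compPowElem_mul, h.mul_flip, MinTensor.tmul_one_one, compPowElem_one,
      MinTensor.tmul_one_one]

end Main

theorem lemma3p2 {S : Type v} [CommMonoid S] (A : S → Type u) [∀ a, CStarAlgebra (A a)]
    (φ : ∀ a b, A (a * b) →⋆ₐ[ℂ] MinTensor (A a) (A b)) (R : ∀ a b, MinTensor (A a) (A b))
    (h : IsLocallyQuasiCocommutative A φ R) (k : ℕ) :
    (∀ a b, opHom (compPow k (φ b a)) = compPow k (opHom (φ b a))) ∧
    IsLocallyQuasiCocommutative (fun a => TPow (A a) k) (fun a b => compPow k (φ a b))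
      (fun a b => compPowElem k (R a b)) ∧
    (IsLocallyQuasiTriangular A φ R →
      IsLocallyQuasiTriangular (fun a => TPow (A a) k) (fun a b => compPow k (φ a b))
        (fun a b => compPowElem k (R a b))) ∧
    (IsLocallyTriangular A φ R →
      IsLocallyTriangular (fun a => TPow (A a) k) (fun a b => compPow k (φ a b))
        (fun a b => compPowElem k (R a b))) :=
  ⟨fun _ _ => opHom_compPow k _, h.compPow k, fun h => h.compPow k, fun h => h.compPow k⟩
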